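/- Let $d\ge 1$ and let $(S(n))_{n\ge0}$ be the simple symmetric nearest-neighbour random walk on $\mathbb Z^d$ started at $0$, with expectation $E$. For $y\in\mathbb Z^d$ let $H(y)=\inf\{n\ge 0: S(n)=y\}$, and for $v:\mathbb Z^d\to[0,\infty)$ put $$e(0,y,v)=E\Big[\exp\Big(-\sum_{n=0}^{H(y)-1}v(S(n))\Big)\mathbf 1_{\{H(y)<\infty\}}\Big].$$ For every $\gamma>0$ let $V_\gamma=(V_\gamma(x))_{x\in\mathbb Z^d}$ be a family of i.i.d. non-negative real random variables; write $\mathbb P$ and $\mathbb E$ for the corresponding probability and expectation. Assume that $V_\gamma(0)/\gamma$ converges in distribution, as $\gamma\searrow0$, to some real random variable $V$ (which is then almost surely non-negative), where $\mathbb E[V]\in[0,\infty]$ may be infinite. Then for every $\gamma>0$ there is exactly one seminorm $\beta_{V_\gamma}$ on $\mathbb R^d$ (the annealed Lyapunov exponent of $V_\gamma$) such that $$\beta_{V_\gamma}(z)=\lim_{k\to\infty}-\frac1k\ln\mathbb E\big[e(0,kz,V_\gamma)\big]\qquad\text{for all } z\in\mathbb Z^d;$$ it is a norm if $\mathbb P[V_\gamma(0)>0]>0$.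 Moreover, for all $\ell\in\mathbb R^d$, $$\liminf_{\gamma\searrow0}\frac{\beta_{V_\gamma}(\ell)}{\sqrt\gamma}\ \ge\ \sqrt{2d\,\mathbb E[V]}\;\|\ell\|_2 ,$$ where the right-hand side is read as $\infty$ if $\mathbb E[V]=\infty$ and $\ell\neq0$, and as $0$ if $\ell=0$. -/

import Mathlib

open MeasureTheory ProbabilityTheory Filter Topology
open scoped ENNReal

noncomputable section

namespace RandomPotential

/-- The step `± e_i` of the nearest-neighbour walk encoded by the pair `(i, ±)`. -/
def step {d : ℕ} (s : Fin d × Bool) : Fin d → ℤ :=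
  Pi.single s.1 (if s.2 then 1 else -1)

/-- The law of the sequence of steps of the simple symmetric random walk on `ℤ^d`, `d ≥ 1`:
the steps are independent and uniformly distributed over the `2d` unit vectors. -/
def walkMeasure (d : ℕ) [NeZero d] : Measure (ℕ → Fin d × Bool) :=
  Measure.infinitePi fun _ => (PMF.uniformOfFintype (Fin d × Bool)).toMeasure

/-- The position `S(n)` of the walk started at `0`. -/
def walk {d : ℕ} (s : ℕ → Fin d × Bool) (n : ℕ) : Fin d → ℤ :=
  ∑ i ∈ Finset.range n, step (s i)

/-- The first passage time `H(y) = inf {n ≥ 0 | S(n) = y}`; it is only meaningful for paths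
that visit `y`, and only used for these. -/
def firstPassage {d : ℕ} (y : Fin d → ℤ) (s : ℕ → Fin d × Bool) : ℕ :=
  sInf {n : ℕ | walk s n = y}

/-- `e(0, y, v) = E[exp(-∑_{n=0}^{H(y)-1} v(S(n))) ; H(y) < ∞]`. -/
def survival {d : ℕ} [NeZero d] (y : Fin d → ℤ) (v : (Fin d → ℤ) → ℝ) : ℝ :=
  ∫ s, {s : ℕ → Fin d × Bool | ∃ n, walk s n = y}.indicator
    (fun s => Real.exp (-∑ n ∈ Finset.range (firstPassage y s), v (walk s n))) s ∂walkMeasure d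

/-- The potential `V = (V(x))_{x ∈ ℤ^d}` consists of i.i.d. non-negative random variables. -/
structure IsIIDPotential {d : ℕ} {Ω : Type*} [MeasurableSpace Ω] (P : Measure Ω)
    (V : (Fin d → ℤ) → Ω → ℝ) : Prop where
  measurable : ∀ x, Measurable (V x)
  nonneg : ∀ x ω, 0 ≤ V x ω
  indep : iIndepFun V P
  identDistrib : ∀ x, IdentDistrib (V x) (V 0) P P

/-- A lattice point as a vector of the Euclidean space `ℝ^d`. -/
def toEuclidean {d : ℕ} (z : Fin d → ℤ) : EuclideanSpace ℝ (Fin d) :=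
  WithLp.toLp 2 fun i => (z i : ℝ)

/-- `p` is the annealed Lyapunov exponent of the potential `V`: a seminorm on `ℝ^d` with
`p(z) = lim_{k → ∞} -(1/k) ln 𝔼[e(0, kz, V)]` for all `z ∈ ℤ^d`. -/
def IsAnnealedExponent {d : ℕ} [NeZero d] {Ω : Type*} [MeasurableSpace Ω] (P : Measure Ω)
    (V : (Fin d → ℤ) → Ω → ℝ) (p : Seminorm ℝ (EuclideanSpace ℝ (Fin d))) : Prop :=
  ∀ z : Fin d → ℤ,
    Tendsto (fun k : ℕ => -1 / (k : ℝ) * Real.log (∫ ω, survival (k • z) (fun x => V x ω) ∂P))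
      atTop (𝓝 (p (toEuclidean z)))

end RandomPotential

end

/-!
Averaging over the potential turns the weight of a path into `∏ φ(L(z))`, where `L` is the field of
local times and `φ k = 𝔼[exp(-k V(0))]`. Since `φ j * φ k ≤ φ (j + k)`, the cost `-ln 𝔼[e(0, y, V)]`
is subadditive, and its stable seminorm extends from `ℤ^d` to `ℝ^d`.

For the lower bound, cut space orthogonally to a direction into slabs of width `R` and charge to
each slab only the local times accumulated there before its right end is first passed. These local
times live on disjoint sets, so the bounds for the single slabs multiply. With
`c = γ 𝔼[min(V_γ(0)/γ, M)]` and `η` of order `γ²` one has `φ k ≤ exp(-c k + η k²)`, so the weight of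
one slab is at most `exp(1 - c T)`, where `T` is the time spent there, unless the self-intersection
sum `Q = ∑ L(z)²` satisfies `η Q ≥ 1`, in which case it is at most `η Q`. The first part decays in
the width like `exp(-√(2dc) R)`, because `exp(-c n) cosh(s Xₙ)` is a supermartingale for `s`
slightly smaller than `√(2dc)`. The expectation of `Q` has order `R³`, so for `R = K/√γ` the second
part is of order `√γ` and vanishes as `γ → 0` for each fixed `K`; then `K → ∞` and `M → ∞`.
-/

noncomputable section

open scoped BigOperators

namespace RandomPotential

/-! ### Weights of local times -/

/-- The properties of `k ↦ 𝔼[exp(-k V)]`, `V ≥ 0`, that govern the annealed walk. -/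
structure IsLocalWeight (φ : ℕ → ℝ) : Prop where
  zero : φ 0 = 1
  pos : ∀ k, 0 < φ k
  antitone : Antitone φ
  mul_le : ∀ j k, φ j * φ k ≤ φ (j + k)

/-- The weight `∏ φ(L(z))` of the field `L` of local times. -/
def fieldWeight {G : Type*} (φ : ℕ → ℝ) (L : G →₀ ℕ) : ℝ := L.prod fun _ k => φ k

section FieldWeight

variable {G : Type*} {φ : ℕ → ℝ} {L L' : G →₀ ℕ}

@[simp]
lemma fieldWeight_zero : fieldWeight φ (0 : G →₀ ℕ) = 1 := Finsupp.prod_zero_index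

lemma fieldWeight_add_of_disjoint (h : Disjoint L.support L'.support) :
    fieldWeight φ (L + L') = fieldWeight φ L * fieldWeight φ L' := by
  classical exact Finsupp.prod_add_index_of_disjoint h _

lemma fieldWeight_equivMapDomain {H : Type*} (e : G ≃ H) (L : G →₀ ℕ) :
    fieldWeight φ (Finsupp.equivMapDomain e L) = fieldWeight φ L :=
  Finsupp.prod_equivMapDomain _ _ _

namespace IsLocalWeight

lemma le_one (hφ : IsLocalWeight φ) (k : ℕ) : φ k ≤ 1 := hφ.zero ▸ hφ.antitone k.zero_le

lemma fieldWeight_eq_prod (hφ : IsLocalWeight φ) {s : Finset G} (h : L.support ⊆ s) :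
    fieldWeight φ L = ∏ z ∈ s, φ (L z) :=
  Finsupp.prod_of_support_subset L h _ fun _ _ => hφ.zero

lemma fieldWeight_single (hφ : IsLocalWeight φ) (z : G) (k : ℕ) :
    fieldWeight φ (Finsupp.single z k) = φ k :=
  Finsupp.prod_single_index hφ.zero

lemma fieldWeight_pos (hφ : IsLocalWeight φ) (L : G →₀ ℕ) : 0 < fieldWeight φ L :=
  Finset.prod_pos fun _ _ => hφ.pos _

lemma fieldWeight_antitone (hφ : IsLocalWeight φ) :
    Antitone (fieldWeight φ : (G →₀ ℕ) → ℝ) := by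
  intro L L' h
  rw [hφ.fieldWeight_eq_prod (Finset.Subset.refl L'.support),
    hφ.fieldWeight_eq_prod (Finsupp.support_mono h)]
  exact Finset.prod_le_prod (fun _ _ => (hφ.pos _).le) fun z _ => hφ.antitone (h z)

lemma fieldWeight_add_le (hφ : IsLocalWeight φ) (L L' : G →₀ ℕ) :
    fieldWeight φ (L + L') ≤ fieldWeight φ L :=
  hφ.fieldWeight_antitone (le_add_of_nonneg_right zero_le)

lemma fieldWeight_le_one (hφ : IsLocalWeight φ) (L : G →₀ ℕ) : fieldWeight φ L ≤ 1 :=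
  (hφ.fieldWeight_antitone zero_le).trans_eq fieldWeight_zero

lemma fieldWeight_mul_le (hφ : IsLocalWeight φ) (L L' : G →₀ ℕ) :
    fieldWeight φ L * fieldWeight φ L' ≤ fieldWeight φ (L + L') := by
  classical
  rw [hφ.fieldWeight_eq_prod (Finset.subset_union_left (s₂ := L'.support)),
    hφ.fieldWeight_eq_prod (Finset.subset_union_right (s₁ := L.support)),
    hφ.fieldWeight_eq_prod (L := L + L') Finsupp.support_add, ← Finset.prod_mul_distrib]
  exact Finset.prod_le_prod (fun _ _ => mul_nonneg (hφ.pos _).le (hφ.pos _).le)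
    fun z _ => hφ.mul_le _ _

end IsLocalWeight

end FieldWeight

/-! ### The annealed walk -/

section AnnealedWalk

variable {G A : Type*} [AddCommGroup G] [Fintype A]

open Classical in
/-- The contribution to `𝔼[exp(-∑ L(z) V(z)) e(x, y, V)]` of the paths from `x` that reach `y`
within `n` steps, for the walk with steps uniform in `σ` and `φ k = 𝔼[exp(-k V(0))]`. -/
def annealed (σ : A → G) (φ : ℕ → ℝ) (y : G) : ℕ → G → (G →₀ ℕ) → ℝ
  | 0, x, L => if x = y then fieldWeight φ L else 0
  | n + 1, x, L => if x = y then fieldWeight φ L else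
      𝔼 a, annealed σ φ y n (x + σ a) (L + Finsupp.single x 1)

variable {σ : A → G} {φ : ℕ → ℝ} {x y : G}

lemma annealed_self (n : ℕ) (L : G →₀ ℕ) : annealed σ φ y n y L = fieldWeight φ L := by
  cases n <;> simp [annealed]

lemma annealed_zero_of_ne (h : x ≠ y) (L : G →₀ ℕ) : annealed σ φ y 0 x L = 0 := by
  simp [annealed, h]

lemma annealed_succ_of_ne (h : x ≠ y) (n : ℕ) (L : G →₀ ℕ) :
    annealed σ φ y (n + 1) x L =
      𝔼 a, annealed σ φ y n (x + σ a) (L + Finsupp.single x 1) := by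
  simp [annealed, h]

namespace IsLocalWeight

lemma annealed_nonneg (hφ : IsLocalWeight φ) (n : ℕ) (x : G) (L : G →₀ ℕ) :
    0 ≤ annealed σ φ y n x L := by
  induction n generalizing x L with
  | zero => rw [annealed]; split_ifs; exacts [(hφ.fieldWeight_pos L).le, le_rfl]
  | succ n ih =>
    rw [annealed]; split_ifs
    exacts [(hφ.fieldWeight_pos L).le, Finset.expect_nonneg fun a _ => ih _ _]

lemma annealed_le_fieldWeight [Nonempty A] (hφ : IsLocalWeight φ) (n : ℕ) (x : G)
    (L : G →₀ ℕ) : annealed σ φ y n x L ≤ fieldWeight φ L := by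
  induction n generalizing x L with
  | zero => rw [annealed]; split_ifs; exacts [le_rfl, (hφ.fieldWeight_pos L).le]
  | succ n ih =>
    rw [annealed]; split_ifs
    exacts [le_rfl, Finset.expect_le Finset.univ_nonempty fun a _ =>
      (ih _ _).trans (hφ.fieldWeight_add_le _ _)]

lemma annealed_le_one [Nonempty A] (hφ : IsLocalWeight φ) (n : ℕ) (x : G) (L : G →₀ ℕ) :
    annealed σ φ y n x L ≤ 1 :=
  (hφ.annealed_le_fieldWeight n x L).trans (hφ.fieldWeight_le_one L)

lemma annealed_monotone (hφ : IsLocalWeight φ) (x : G) (L : G →₀ ℕ) :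
    Monotone fun n => annealed σ φ y n x L := by
  refine monotone_nat_of_le_succ fun n => ?_
  induction n generalizing x L with
  | zero =>
    obtain rfl | h := eq_or_ne x y
    · rw [annealed_self, annealed_self]
    · rw [annealed_zero_of_ne h]; exact hφ.annealed_nonneg _ _ _
  | succ n ih =>
    obtain rfl | h := eq_or_ne x y
    · rw [annealed_self, annealed_self]
    · rw [annealed_succ_of_ne h, annealed_succ_of_ne h]
      exact Finset.expect_le_expect fun a _ => ih _ _

lemma fieldWeight_mul_annealed_le (hφ : IsLocalWeight φ) (n : ℕ) (x : G) (L L' : G →₀ ℕ) :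
    fieldWeight φ L * annealed σ φ y n x L' ≤ annealed σ φ y n x (L + L') := by
  induction n generalizing x L' with
  | zero =>
    obtain rfl | h := eq_or_ne x y
    · rw [annealed_self, annealed_self]; exact hφ.fieldWeight_mul_le _ _
    · rw [annealed_zero_of_ne h, annealed_zero_of_ne h, mul_zero]
  | succ n ih =>
    obtain rfl | h := eq_or_ne x y
    · rw [annealed_self, annealed_self]; exact hφ.fieldWeight_mul_le _ _
    · rw [annealed_succ_of_ne h, annealed_succ_of_ne h, Finset.mul_expect]
      exact Finset.expect_le_expect fun a _ => (ih _ _).trans_eq (by rw [add_assoc])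

lemma annealed_mul_le [Nonempty A] (hφ : IsLocalWeight φ) {z : G} (n m : ℕ) (x : G)
    (L : G →₀ ℕ) :
    annealed σ φ y n x L * annealed σ φ z m y 0 ≤ annealed σ φ z (n + m) x L := by
  induction n generalizing x L with
  | zero =>
    obtain rfl | hy := eq_or_ne x y
    · rw [annealed_self, zero_add]
      simpa using hφ.fieldWeight_mul_annealed_le m x L 0
    · rw [annealed_zero_of_ne hy, zero_mul]; exact hφ.annealed_nonneg _ _ _
  | succ n ih =>
    obtain rfl | hz := eq_or_ne x z
    · rw [annealed_self]
      exact (mul_le_of_le_one_right (hφ.annealed_nonneg _ _ _) (hφ.annealed_le_one _ _ _)).trans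
        (hφ.annealed_le_fieldWeight _ _ _)
    obtain rfl | hy := eq_or_ne x y
    · rw [annealed_self]
      refine le_trans ?_ (hφ.annealed_monotone x L (Nat.le_add_left m (n + 1)))
      simpa using hφ.fieldWeight_mul_annealed_le m x L 0
    · rw [annealed_succ_of_ne hy, Nat.add_right_comm, annealed_succ_of_ne hz, Finset.expect_mul]
      exact Finset.expect_le_expect fun a _ => ih _ _

end IsLocalWeight

lemma annealed_equiv (τ : G ≃ G) (e : A ≃ A) (h : ∀ x a, τ (x + σ a) = τ x + σ (e a)) (n : ℕ)
    (x : G) (L : G →₀ ℕ) :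
    annealed σ φ (τ y) n (τ x) (Finsupp.equivMapDomain τ L) = annealed σ φ y n x L := by
  induction n generalizing x L with
  | zero =>
    obtain rfl | hx := eq_or_ne x y
    · rw [annealed_self, annealed_self, fieldWeight_equivMapDomain]
    · rw [annealed_zero_of_ne hx, annealed_zero_of_ne (τ.injective.ne hx)]
  | succ n ih =>
    obtain rfl | hx := eq_or_ne x y
    · rw [annealed_self, annealed_self, fieldWeight_equivMapDomain]
    · rw [annealed_succ_of_ne hx, annealed_succ_of_ne (τ.injective.ne hx)]
      refine (Fintype.expect_equiv e _ _ fun a => ?_).symm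
      have hL : Finsupp.equivMapDomain τ (L + Finsupp.single x 1) =
          Finsupp.equivMapDomain τ L + Finsupp.single (τ x) 1 := by
        classical
        ext z
        simp [Finsupp.equivMapDomain_apply, Finsupp.single_apply, Equiv.eq_symm_apply]
      rw [← ih, hL, h]

lemma annealed_add_left (w : G) (n : ℕ) (x : G) :
    annealed σ φ (w + y) n (w + x) 0 = annealed σ φ y n x 0 := by
  simpa using annealed_equiv (φ := φ) (y := y) (Equiv.addLeft w) (Equiv.refl A)
    (fun x a => by simp [add_assoc]) n x 0

lemma annealed_neg {e : A ≃ A} (he : ∀ a, σ (e a) = -σ a) (n : ℕ) :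
    annealed σ φ (-y) n 0 0 = annealed σ φ y n 0 0 := by
  simpa using annealed_equiv (φ := φ) (y := y) (Equiv.neg G) e
    (fun x a => by simp [he, add_comm]) n 0 0

end AnnealedWalk

/-! ### Crossing fresh slabs -/

section Slabs

variable {G A : Type*} [AddCommGroup G] [Fintype A] {σ : A → G} {φ : ℕ → ℝ} {X : G →+ ℝ}
  {R ρ r : ℝ} {x y : G} {B C : G →₀ ℕ}

/-- `Ψ r x C` majorizes the annealed weight picked up inside the slab `r ≤ X < r + R` until its
right end is passed, when the walk is at `x` and has left the local times `C` in the slab. -/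
structure IsSlabMajorant (σ : A → G) (φ : ℕ → ℝ) (X : G →+ ℝ) (R ρ : ℝ)
    (Ψ : ℝ → G → (G →₀ ℕ) → ℝ) : Prop where
  nonneg : ∀ r x C, (∀ z ∈ C.support, X z ∈ Set.Ico r (r + R)) → X x < r + R → 0 ≤ Ψ r x C
  inside : ∀ r x C, (∀ z ∈ C.support, X z ∈ Set.Ico r (r + R)) → X x ∈ Set.Ico r (r + R) →
    𝔼 a, Ψ r (x + σ a) (C + Finsupp.single x 1) ≤ Ψ r x C
  below : ∀ r x C, (∀ z ∈ C.support, X z ∈ Set.Ico r (r + R)) → X x < r →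
    𝔼 a, Ψ r (x + σ a) C ≤ Ψ r x C
  exit : ∀ r x C, (∀ z ∈ C.support, X z ∈ Set.Ico r (r + R)) →
    X x ∈ Set.Ico (r + R) (r + R + 1) → fieldWeight φ C ≤ Ψ r x C
  start : ∀ r x, X x ∈ Set.Ico r (r + 1) → Ψ r x 0 ≤ ρ

/-- The bound for walks of at most `n` steps that still have to leave the slab
`r ≤ X < r + R` and to cross `j` further ones before they can reach `y`; `B` are the local times
to the left of the slab and `C` those inside it. -/
def HasCrossingBound (σ : A → G) (φ : ℕ → ℝ) (X : G →+ ℝ) (R ρ : ℝ)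
    (Ψ : ℝ → G → (G →₀ ℕ) → ℝ) (y : G) (n : ℕ) : Prop :=
  ∀ (j : ℕ) (r : ℝ) (x : G) (B C : G →₀ ℕ), (∀ z ∈ B.support, X z < r) →
    (∀ z ∈ C.support, X z ∈ Set.Ico r (r + R)) → X x < r + R → r + (j + 1) * R ≤ X y →
    annealed σ φ y n x (B + C) ≤ fieldWeight φ B * Ψ r x C * ρ ^ j

lemma fieldWeight_add_of_slab (hB : ∀ z ∈ B.support, X z < r)
    (hC : ∀ z ∈ C.support, X z ∈ Set.Ico r (r + R)) :
    fieldWeight φ (B + C) = fieldWeight φ B * fieldWeight φ C :=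
  fieldWeight_add_of_disjoint <| Finset.disjoint_left.2 fun z hzB hzC =>
    (hB z hzB).not_ge (hC z hzC).1

lemma forall_mem_support_add {α : Type*} {p : α → Prop} {L L' : α →₀ ℕ}
    (hL : ∀ z ∈ L.support, p z) (hL' : ∀ z ∈ L'.support, p z) :
    ∀ z ∈ (L + L').support, p z := by
  classical exact fun z hz => (Finset.mem_union.1 (Finsupp.support_add hz)).elim (hL z) (hL' z)

lemma forall_mem_support_add_single {α : Type*} {p : α → Prop} {L : α →₀ ℕ} {x : α}
    (hL : ∀ z ∈ L.support, p z) (hx : p x) : ∀ z ∈ (L + Finsupp.single x 1).support, p z :=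
  forall_mem_support_add hL fun _ hz =>
    Finset.mem_singleton.1 (Finsupp.support_single_subset hz) ▸ hx

namespace IsSlabMajorant

variable {Ψ : ℝ → G → (G →₀ ℕ) → ℝ}

lemma start_nonneg (hΨ : IsSlabMajorant σ φ X R ρ Ψ) (hR : 1 ≤ R) : 0 ≤ ρ := by
  refine (hΨ.nonneg 0 0 0 ?_ ?_).trans (hΨ.start 0 0 ?_) <;> simp
  linarith

lemma annealed_le_of_exit [Nonempty A] (hΨ : IsSlabMajorant σ φ X R ρ Ψ) (hφ : IsLocalWeight φ)
    (hR : 1 ≤ R) {n j : ℕ} (hn : HasCrossingBound σ φ X R ρ Ψ y n)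
    (hB : ∀ z ∈ B.support, X z < r) (hC : ∀ z ∈ C.support, X z ∈ Set.Ico r (r + R))
    (hx : X x ∈ Set.Ico (r + R) (r + R + 1)) (hy : r + (j + 1) * R ≤ X y) :
    annealed σ φ y n x (B + C) ≤ fieldWeight φ B * Ψ r x C * ρ ^ j := by
  have hB0 := (hφ.fieldWeight_pos B).le
  have hle : fieldWeight φ (B + C) ≤ fieldWeight φ B * Ψ r x C := by
    rw [fieldWeight_add_of_slab hB hC]
    exact mul_le_mul_of_nonneg_left (hΨ.exit r x C hC hx) hB0
  cases j with
  | zero => simpa using (hφ.annealed_le_fieldWeight n x (B + C)).trans hle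
  | succ j =>
    have hBC : ∀ z ∈ (B + C).support, X z < r + R :=
      forall_mem_support_add (fun z hz => (hB z hz).trans (by linarith)) fun z hz => (hC z hz).2
    have hnext := hn j (r + R) x (B + C) 0 hBC (by simp) (hx.2.trans_le (by linarith))
      (by push_cast at hy; linarith)
    rw [add_zero] at hnext
    refine hnext.trans ?_
    rw [pow_succ', ← mul_assoc]
    exact mul_le_mul_of_nonneg_right
      (mul_le_mul hle (hΨ.start _ _ hx) (hΨ.nonneg _ _ _ (by simp) (hx.2.trans_le (by linarith)))
        ((hφ.fieldWeight_pos _).le.trans hle)) (pow_nonneg (hΨ.start_nonneg hR) j)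

lemma hasCrossingBound_succ [Nonempty A] (hΨ : IsSlabMajorant σ φ X R ρ Ψ)
    (hφ : IsLocalWeight φ) (hX : ∀ a, X (σ a) ≤ 1) (hR : 1 ≤ R) {n : ℕ}
    (hn : HasCrossingBound σ φ X R ρ Ψ y n) : HasCrossingBound σ φ X R ρ Ψ y (n + 1) := by
  intro j r x B C hB hC hx hy
  have hxy : x ≠ y := by rintro rfl; nlinarith [(Nat.cast_nonneg j : (0 : ℝ) ≤ j)]
  have hB0 := (hφ.fieldWeight_pos B).le
  have hρ := pow_nonneg (hΨ.start_nonneg hR) j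
  have hstep (a : A) : X (x + σ a) ≤ X x + 1 := by rw [map_add]; linarith [hX a]
  rw [annealed_succ_of_ne hxy]
  obtain hr | hr := lt_or_ge (X x) r
  · calc 𝔼 a, annealed σ φ y n (x + σ a) (B + C + Finsupp.single x 1)
        ≤ 𝔼 a, fieldWeight φ B * Ψ r (x + σ a) C * ρ ^ j := by
          refine Finset.expect_le_expect fun a _ => ?_
          have hxa : X (x + σ a) < r + R := by linarith [hstep a]
          rw [add_right_comm]
          exact (hn j r _ _ C (forall_mem_support_add_single hB hr) hC hxa hy).trans <|
            mul_le_mul_of_nonneg_right (mul_le_mul_of_nonneg_right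
              (hφ.fieldWeight_add_le _ _) (hΨ.nonneg _ _ _ hC hxa)) hρ
      _ ≤ fieldWeight φ B * Ψ r x C * ρ ^ j := by
          rw [← Finset.expect_mul, ← Finset.mul_expect]
          gcongr
          exact hΨ.below r x C hC hr
  · have hC' := forall_mem_support_add_single hC ⟨hr, hx⟩
    calc 𝔼 a, annealed σ φ y n (x + σ a) (B + C + Finsupp.single x 1)
        ≤ 𝔼 a, fieldWeight φ B * Ψ r (x + σ a) (C + Finsupp.single x 1) * ρ ^ j := by
          refine Finset.expect_le_expect fun a _ => ?_
          rw [add_assoc]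
          obtain hxa | hxa := lt_or_ge (X (x + σ a)) (r + R)
          · exact hn j r _ B _ hB hC' hxa hy
          · exact hΨ.annealed_le_of_exit hφ hR hn hB hC' ⟨hxa, by linarith [hstep a]⟩ hy
      _ ≤ fieldWeight φ B * Ψ r x C * ρ ^ j := by
          rw [← Finset.expect_mul, ← Finset.mul_expect]
          gcongr
          exact hΨ.inside r x C hC ⟨hr, hx⟩

lemma hasCrossingBound [Nonempty A] (hΨ : IsSlabMajorant σ φ X R ρ Ψ) (hφ : IsLocalWeight φ)
    (hX : ∀ a, X (σ a) ≤ 1) (hR : 1 ≤ R) (n : ℕ) : HasCrossingBound σ φ X R ρ Ψ y n := by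
  induction n with
  | zero =>
    intro j r x B C _ hC hx hy
    have hxy : x ≠ y := by rintro rfl; nlinarith [(Nat.cast_nonneg j : (0 : ℝ) ≤ j)]
    rw [annealed_zero_of_ne hxy]
    exact mul_nonneg (mul_nonneg (hφ.fieldWeight_pos B).le (hΨ.nonneg r x C hC hx))
      (pow_nonneg (hΨ.start_nonneg hR) j)
  | succ n ih => exact hΨ.hasCrossingBound_succ hφ hX hR ih

lemma annealed_le_pow [Nonempty A] (hΨ : IsSlabMajorant σ φ X R ρ Ψ) (hφ : IsLocalWeight φ)
    (hX : ∀ a, X (σ a) ≤ 1) (hR : 1 ≤ R) (n j : ℕ) (hy : j * R ≤ X y) :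
    annealed σ φ y n 0 0 ≤ ρ ^ j := by
  cases j with
  | zero => simpa using hφ.annealed_le_one n 0 0
  | succ j =>
    have hcross := hΨ.hasCrossingBound hφ hX hR n j 0 0 0 0 (by simp) (by simp)
      (by simp; linarith) (by simpa using hy)
    rw [add_zero, fieldWeight_zero, one_mul] at hcross
    rw [pow_succ']
    exact hcross.trans <| mul_le_mul_of_nonneg_right (hΨ.start 0 0 (by simp))
      (pow_nonneg (hΨ.start_nonneg hR) j)

end IsSlabMajorant

open Classical in
/-- The majorant for slabs of width `1` that expresses that each of them contains a visited
site. -/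
def visitMajorant (φ : ℕ → ℝ) (X : G →+ ℝ) (r : ℝ) (x : G) (C : G →₀ ℕ) : ℝ :=
  if C ≠ 0 ∨ X x < r + 1 then φ 1 else 1

lemma isSlabMajorant_visitMajorant [Nonempty A] (hφ : IsLocalWeight φ)
    (hX : ∀ a, X (σ a) ≤ 1) : IsSlabMajorant σ φ X 1 (φ 1) (visitMajorant φ X) where
  nonneg r x C _ _ := by unfold visitMajorant; split_ifs; exacts [(hφ.pos 1).le, zero_le_one]
  inside r x C _ hx := by
    have hC : C + Finsupp.single x 1 ≠ 0 := fun h => by simpa using DFunLike.congr_fun h x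
    simp [visitMajorant, hC, hx.2]
  below r x C _ hx := by
    have hxa (a : A) : X x + X (σ a) < r + 1 := by linarith [hX a]
    simp [visitMajorant, hxa, hx.trans (lt_add_one r)]
  exit r x C _ hx := by
    obtain rfl | hC := eq_or_ne C 0
    · simp [visitMajorant, hx.1.not_gt]
    · obtain ⟨z, hz⟩ := Finsupp.ne_iff.1 hC
      have hzC : Finsupp.single z 1 ≤ C := Finsupp.single_le_iff.2 (Nat.one_le_iff_ne_zero.2 hz)
      rw [visitMajorant, if_pos (Or.inl hC), ← hφ.fieldWeight_single z 1]
      exact hφ.fieldWeight_antitone hzC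
  start r x hx := by rw [visitMajorant, if_pos (Or.inr hx.2)]

end Slabs

/-! ### Symmetric increments -/

section Increments

variable {A : Type*} [Fintype A] {ξ : A → ℝ} {e : A ≃ A}

lemma expect_eq_zero_of_odd (he : ∀ a, ξ (e a) = -ξ a) : 𝔼 a, ξ a = 0 := by
  have h : 𝔼 a, ξ a = 𝔼 a, -ξ a := Fintype.expect_equiv e.symm _ _ fun a => by simp [← he]
  rw [Finset.expect_neg_distrib] at h
  linarith

lemma expect_cosh_mul_max_le (he : ∀ a, ξ (e a) = -ξ a) {s c : ℝ}
    (hc : 𝔼 a, Real.cosh (s * ξ a) ≤ Real.exp c) (t : ℝ) :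
    𝔼 a, Real.cosh (s * max (t + ξ a) 0) ≤ Real.exp c * Real.cosh (s * max t 0) := by
  have hle (a : A) : Real.cosh (s * max (t + ξ a) 0) ≤
      Real.cosh (s * max t 0) * Real.cosh (s * ξ a) +
        Real.sinh (s * max t 0) * Real.sinh (s * ξ a) := by
    rw [← Real.cosh_add, ← mul_add, Real.cosh_le_cosh, abs_mul, abs_mul]
    refine mul_le_mul_of_nonneg_left ?_ (abs_nonneg s)
    rw [abs_of_nonneg (le_max_right _ _)]
    exact max_le ((add_le_add_left (le_max_left t 0) _).trans (le_abs_self _)) (abs_nonneg _)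
  have hsinh : 𝔼 a, Real.sinh (s * ξ a) = 0 :=
    expect_eq_zero_of_odd (e := e) fun a => by rw [he, mul_neg, Real.sinh_neg]
  calc 𝔼 a, Real.cosh (s * max (t + ξ a) 0)
      ≤ 𝔼 a, (Real.cosh (s * max t 0) * Real.cosh (s * ξ a) +
          Real.sinh (s * max t 0) * Real.sinh (s * ξ a)) :=
        Finset.expect_le_expect fun a _ => hle a
    _ = (𝔼 a, Real.cosh (s * ξ a)) * Real.cosh (s * max t 0) := by
        rw [Finset.expect_add_distrib, ← Finset.mul_expect, ← Finset.mul_expect, hsinh]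
        ring
    _ ≤ Real.exp c * Real.cosh (s * max t 0) :=
        mul_le_mul_of_nonneg_right hc (Real.cosh_pos _).le

variable [Nonempty A]

lemma max_le_expect_max (h0 : 𝔼 a, ξ a = 0) (u t : ℝ) : max u t ≤ 𝔼 a, max u (t + ξ a) := by
  refine max_le (Finset.le_expect Finset.univ_nonempty fun a _ => le_max_left _ _) ?_
  calc t = 𝔼 a, (t + ξ a) := by rw [Finset.expect_add_distrib, Fintype.expect_const, h0, add_zero]
    _ ≤ 𝔼 a, max u (t + ξ a) := Finset.expect_le_expect fun a _ => le_max_right _ _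

lemma add_le_expect_max (h0 : 𝔼 a, ξ a = 0) (h1 : ∀ a, |ξ a| ≤ 1) (t : ℝ) :
    t + (𝔼 a, ξ a ^ 2) / 2 ≤ 𝔼 a, max t (t + ξ a) := by
  have hle (a : A) : t + 1 / 2 * (ξ a + ξ a ^ 2) ≤ max t (t + ξ a) := by
    obtain ⟨hl, hr⟩ := abs_le.1 (h1 a)
    obtain h | h := le_total 0 (ξ a)
    · exact le_max_of_le_right (by nlinarith)
    · exact le_max_of_le_left (by nlinarith)
  calc t + (𝔼 a, ξ a ^ 2) / 2 = 𝔼 a, (t + 1 / 2 * (ξ a + ξ a ^ 2)) := by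
        rw [Finset.expect_add_distrib, Fintype.expect_const, ← Finset.mul_expect,
          Finset.expect_add_distrib, h0]
        ring
    _ ≤ 𝔼 a, max t (t + ξ a) := Finset.expect_le_expect fun a _ => hle a

lemma sq_max_le_expect_sq_max (h0 : 𝔼 a, ξ a = 0) (t : ℝ) :
    max t 0 ^ 2 ≤ 𝔼 a, max (t + ξ a) 0 ^ 2 := by
  have hle (a : A) : max t 0 ^ 2 + 2 * max t 0 * ξ a ≤ max (t + ξ a) 0 ^ 2 := by
    obtain h | h := le_total 0 t
    · rw [max_eq_left h]
      obtain h' | h' := le_total 0 (t + ξ a)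
      · rw [max_eq_left h']; nlinarith [sq_nonneg (ξ a)]
      · rw [max_eq_right h']; nlinarith
    · simp [max_eq_right h]
  calc max t 0 ^ 2 = 𝔼 a, (max t 0 ^ 2 + 2 * max t 0 * ξ a) := by
        rw [Finset.expect_add_distrib, Fintype.expect_const, ← Finset.mul_expect, h0, mul_zero,
          add_zero]
    _ ≤ 𝔼 a, max (t + ξ a) 0 ^ 2 := Finset.expect_le_expect fun a _ => hle a

lemma expect_sq_max_eq (h0 : 𝔼 a, ξ a = 0) {t : ℝ} (ht : ∀ a, 0 ≤ t + ξ a) :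
    𝔼 a, max (t + ξ a) 0 ^ 2 = t ^ 2 + 𝔼 a, ξ a ^ 2 := by
  simp only [max_eq_left (ht _), add_sq, Finset.expect_add_distrib, Fintype.expect_const,
    ← Finset.mul_expect, h0, mul_zero, add_zero]

end Increments

/-! ### The self-intersections inside a slab -/

/-- The sum of the squared local times. -/
def selfIntersection {G : Type*} (C : G →₀ ℕ) : ℝ := C.sum fun _ k => (k : ℝ) ^ 2

lemma selfIntersection_nonneg {G : Type*} (C : G →₀ ℕ) : 0 ≤ selfIntersection C :=
  Finset.sum_nonneg fun _ _ => sq_nonneg _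

lemma selfIntersection_add_single {G : Type*} (C : G →₀ ℕ) (x : G) :
    selfIntersection (C + Finsupp.single x 1) = selfIntersection C + 2 * C x + 1 := by
  classical
  have hsupp : (C + Finsupp.single x 1).support ⊆ insert x C.support := fun z =>
    forall_mem_support_add_single (p := (· ∈ insert x C.support))
      (fun _ => Finset.mem_insert_of_mem) (Finset.mem_insert_self x _) z
  have hterm (z : G) : (((C + Finsupp.single x 1 : G →₀ ℕ) z : ℕ) : ℝ) ^ 2 =
      (C z : ℝ) ^ 2 + if z = x then 2 * (C x : ℝ) + 1 else 0 := by
    obtain rfl | h := eq_or_ne z x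
    · simp; ring
    · simp [h]
  rw [selfIntersection, selfIntersection, Finsupp.sum_of_support_subset _ hsupp _ (by simp),
    Finsupp.sum_of_support_subset _ (Finset.subset_insert x _) _ (by simp)]
  simp only [hterm, Finset.sum_add_distrib, Finset.sum_ite_eq', Finset.mem_insert_self, if_true]
  ring

lemma fieldWeight_le_exp {G : Type*} {φ : ℕ → ℝ} (hφ : IsLocalWeight φ) {c η : ℝ}
    (h : ∀ k : ℕ, φ k ≤ Real.exp (-c * k + η * (k : ℝ) ^ 2)) (C : G →₀ ℕ) :
    fieldWeight φ C ≤ Real.exp (-c * C.degree + η * selfIntersection C) := by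
  simp only [fieldWeight, selfIntersection, Finsupp.degree_apply, Finsupp.prod, Finsupp.sum,
    Nat.cast_sum]
  rw [Finset.mul_sum, Finset.mul_sum, ← Finset.sum_add_distrib, Real.exp_sum]
  exact Finset.prod_le_prod (fun _ _ => (hφ.pos _).le) fun z _ => h _

section IntersectionMajorant

variable {G A : Type*} [AddCommGroup G] {σ : A → G} {X : G →+ ℝ} {D R r b : ℝ} {x : G}
  {C : G →₀ ℕ}

/-- The majorant of the future growth of `selfIntersection` caused by returns to old sites. -/
def returnPotential (X : G →+ ℝ) (b : ℝ) (x : G) (C : G →₀ ℕ) : ℝ :=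
  C.sum fun z k => (k : ℝ) * (b - max (X z) (X x))

lemma returnPotential_nonneg (hx : X x ≤ b) (hC : ∀ z ∈ C.support, X z ≤ b) :
    0 ≤ returnPotential X b x C :=
  Finset.sum_nonneg fun z hz =>
    mul_nonneg (Nat.cast_nonneg _) (sub_nonneg.2 (max_le (hC z hz) hx))

lemma returnPotential_add_single (X : G →+ ℝ) (b : ℝ) (w x : G) (C : G →₀ ℕ) :
    returnPotential X b w (C + Finsupp.single x 1) =
      returnPotential X b w C + (b - max (X x) (X w)) := by
  classical
  rw [returnPotential, Finsupp.sum_add_index' (by simp) (by intros; push_cast; ring)]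
  simp [returnPotential]

variable [Fintype A] [Nonempty A]

lemma expect_returnPotential (X : G →+ ℝ) (b : ℝ) (x : G) (C : G →₀ ℕ) :
    𝔼 a, returnPotential X b (x + σ a) C =
      C.sum fun z k => (k : ℝ) * (b - 𝔼 a, max (X z) (X x + X (σ a))) := by
  simp only [returnPotential, Finsupp.sum, Finset.expect_sum_comm, ← Finset.mul_expect,
    Finset.expect_sub_distrib, Fintype.expect_const, map_add]

lemma expect_returnPotential_le (h0 : 𝔼 a, X (σ a) = 0) :
    𝔼 a, returnPotential X b (x + σ a) C ≤ returnPotential X b x C := by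
  rw [expect_returnPotential]
  exact Finset.sum_le_sum fun z _ => mul_le_mul_of_nonneg_left
    (sub_le_sub_left (max_le_expect_max h0 _ _) b) (Nat.cast_nonneg _)

lemma expect_returnPotential_le_sub (h0 : 𝔼 a, X (σ a) = 0) (h1 : ∀ a, |X (σ a)| ≤ 1) :
    𝔼 a, returnPotential X b (x + σ a) C ≤
      returnPotential X b x C - C x * ((𝔼 a, X (σ a) ^ 2) / 2) := by
  classical
  have hself : (C x : ℝ) * ((𝔼 a, X (σ a) ^ 2) / 2) =
      C.sum fun z k => if z = x then (k : ℝ) * ((𝔼 a, X (σ a) ^ 2) / 2) else 0 := by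
    rw [Finsupp.sum_ite_eq' C x fun _ k => (k : ℝ) * ((𝔼 a, X (σ a) ^ 2) / 2)]
    split_ifs with h
    · rfl
    · simp [Finsupp.notMem_support_iff.1 h]
  rw [expect_returnPotential, hself, returnPotential, ← Finsupp.sum_sub]
  refine Finset.sum_le_sum fun z _ => ?_
  dsimp only
  obtain rfl | h := eq_or_ne z x
  · rw [if_pos rfl, ← mul_sub, max_self]
    exact mul_le_mul_of_nonneg_left (by linarith [add_le_expect_max h0 h1 (X z)])
      (Nat.cast_nonneg _)
  · rw [if_neg h, sub_zero]
    exact mul_le_mul_of_nonneg_left (sub_le_sub_left (max_le_expect_max h0 _ _) b)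
      (Nat.cast_nonneg _)

/-- A majorant of the expected final value of `selfIntersection` in the slab `r ≤ X < r + R`, for
steps whose variance `s` along `X` satisfies `1 ≤ D * s`. The last term pays for the new visits:
`(X - r + 1)₊²` is a submartingale that gains `s` at each of them. -/
def intersectionMajorant (X : G →+ ℝ) (D R r : ℝ) (x : G) (C : G →₀ ℕ) : ℝ :=
  selfIntersection C + 4 * D * returnPotential X (r + R + 1) x C +
    D * (1 + 4 * D * (R + 1)) * ((R + 2) ^ 2 - max (X x - r + 1) 0 ^ 2)

lemma selfIntersection_le_intersectionMajorant (hD : 0 ≤ D) (hR : 1 ≤ R)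
    (hC : ∀ z ∈ C.support, X z ∈ Set.Ico r (r + R)) (hx : X x < r + R + 1) :
    selfIntersection C ≤ intersectionMajorant X D R r x C := by
  have hret : 0 ≤ returnPotential X (r + R + 1) x C :=
    returnPotential_nonneg hx.le fun z hz => by linarith [(hC z hz).2]
  have hsq : 0 ≤ (R + 2) ^ 2 - max (X x - r + 1) 0 ^ 2 :=
    sub_nonneg.2 <| pow_le_pow_left₀ (le_max_right _ _) (max_le (by linarith) (by linarith)) 2
  rw [intersectionMajorant, add_assoc]
  exact le_add_of_nonneg_right (by positivity)

lemma expect_intersectionMajorant (L : G →₀ ℕ) :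
    𝔼 a, intersectionMajorant X D R r (x + σ a) L =
      selfIntersection L + 4 * D * 𝔼 a, returnPotential X (r + R + 1) (x + σ a) L +
        D * (1 + 4 * D * (R + 1)) *
          ((R + 2) ^ 2 - 𝔼 a, max (X x - r + 1 + X (σ a)) 0 ^ 2) := by
  have harg (a : A) : X (x + σ a) - r + 1 = X x - r + 1 + X (σ a) := by rw [map_add]; ring
  simp only [intersectionMajorant, harg, Finset.expect_add_distrib, Finset.expect_sub_distrib,
    ← Finset.mul_expect, Fintype.expect_const]

lemma expect_intersectionMajorant_le_of_below (h0 : 𝔼 a, X (σ a) = 0) (hD : 0 ≤ D)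
    (hR : 1 ≤ R) :
    𝔼 a, intersectionMajorant X D R r (x + σ a) C ≤ intersectionMajorant X D R r x C := by
  rw [expect_intersectionMajorant, intersectionMajorant]
  gcongr
  · exact expect_returnPotential_le h0
  · exact sq_max_le_expect_sq_max h0 _

lemma expect_intersectionMajorant_le_of_inside (h0 : 𝔼 a, X (σ a) = 0)
    (h1 : ∀ a, |X (σ a)| ≤ 1) (hD : 0 ≤ D) (hvar : 1 ≤ D * 𝔼 a, X (σ a) ^ 2) (hR : 1 ≤ R)
    (hx : r ≤ X x) :
    𝔼 a, intersectionMajorant X D R r (x + σ a) (C + Finsupp.single x 1) ≤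
      intersectionMajorant X D R r x C := by
  have hnew : 𝔼 a, (r + R + 1 - max (X x) (X (x + σ a))) ≤ R + 1 :=
    Finset.expect_le Finset.univ_nonempty fun a _ => by
      linarith [le_max_left (X x) (X (x + σ a))]
  have hret := mul_le_mul_of_nonneg_left
    (add_le_add (expect_returnPotential_le_sub (b := r + R + 1) (x := x) (C := C) h0 h1) hnew)
    (by positivity : 0 ≤ 4 * D)
  have hvisit := le_mul_of_one_le_right (by positivity : (0 : ℝ) ≤ 2 * C x) hvar
  have hgain := le_mul_of_one_le_right (by positivity : 0 ≤ 1 + 4 * D * (R + 1)) hvar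
  simp only [expect_intersectionMajorant, returnPotential_add_single, selfIntersection_add_single,
    Finset.expect_add_distrib]
  rw [expect_sq_max_eq h0 fun a => by linarith [(abs_le.1 (h1 a)).1], intersectionMajorant,
    max_eq_left (by linarith : 0 ≤ X x - r + 1)]
  linarith

end IntersectionMajorant

/-! ### Slabs with a quadratic upper bound on the weight -/

section SlabMajorant

variable {G A : Type*} [AddCommGroup G] [Fintype A] {σ : A → G} {e : A ≃ A} {φ : ℕ → ℝ}
  {X : G →+ ℝ} {D R s c η r : ℝ} {x : G} {C : G →₀ ℕ}

/-- The majorant of `e · exp(-c T)`, where `T` is the time spent in the slab `r ≤ X < r + R`; it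
comes from the supermartingale `exp(-c n) cosh(s Xₙ)`. -/
def exitMajorant (X : G →+ ℝ) (R s c r : ℝ) (x : G) (C : G →₀ ℕ) : ℝ :=
  Real.exp 1 / Real.cosh (s * (R - 1)) * Real.exp (-c * C.degree) *
    Real.cosh (s * max (X x - r - 1) 0)

lemma exitMajorant_nonneg : 0 ≤ exitMajorant X R s c r x C := by
  unfold exitMajorant
  have := Real.cosh_pos (s * (R - 1))
  have := Real.cosh_pos (s * max (X x - r - 1) 0)
  positivity

lemma expect_exitMajorant_le_of_inside (he : ∀ a, σ (e a) = -σ a)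
    (hc : 𝔼 a, Real.cosh (s * X (σ a)) ≤ Real.exp c) :
    𝔼 a, exitMajorant X R s c r (x + σ a) (C + Finsupp.single x 1) ≤
      exitMajorant X R s c r x C := by
  have harg (a : A) : X (x + σ a) - r - 1 = X x - r - 1 + X (σ a) := by rw [map_add]; ring
  have hcosh := expect_cosh_mul_max_le (ξ := fun a => X (σ a)) (e := e) (by simp [he]) hc
    (X x - r - 1)
  have hdeg : Real.exp (-c * C.degree) =
      Real.exp (-c * (C + Finsupp.single x 1).degree) * Real.exp c := by
    rw [← Real.exp_add, map_add, Finsupp.degree_single]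
    push_cast
    ring_nf
  simp only [exitMajorant, harg, ← Finset.mul_expect]
  rw [hdeg, ← mul_assoc, mul_assoc _ (Real.exp c)]
  exact mul_le_mul_of_nonneg_left hcosh (by have := Real.cosh_pos (s * (R - 1)); positivity)

lemma expect_exitMajorant_of_below [Nonempty A] (h1 : ∀ a, |X (σ a)| ≤ 1) (hx : X x < r) :
    𝔼 a, exitMajorant X R s c r (x + σ a) C = exitMajorant X R s c r x C := by
  have hxa (a : A) : max (X (x + σ a) - r - 1) 0 = 0 :=
    max_eq_right (by rw [map_add]; linarith [(abs_le.1 (h1 a)).2])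
  simp only [exitMajorant, hxa, Fintype.expect_const,
    max_eq_right (by linarith : X x - r - 1 ≤ 0)]

lemma exp_le_exitMajorant_of_exit (hR : 1 ≤ R) (hx : r + R ≤ X x) :
    Real.exp 1 * Real.exp (-c * C.degree) ≤ exitMajorant X R s c r x C := by
  have hcosh : Real.cosh (s * (R - 1)) ≤ Real.cosh (s * max (X x - r - 1) 0) := by
    rw [Real.cosh_le_cosh, abs_mul, abs_mul, abs_of_nonneg (by linarith : 0 ≤ R - 1),
      abs_of_nonneg (le_max_right _ (0 : ℝ))]
    exact mul_le_mul_of_nonneg_left (le_max_of_le_left (by linarith)) (abs_nonneg s)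
  rw [exitMajorant, div_mul_eq_mul_div, div_mul_eq_mul_div, le_div_iff₀ (Real.cosh_pos _)]
  exact mul_le_mul_of_nonneg_left hcosh (by positivity)

/-- The factor gained in a slab of width `R`: exponential decay at rate `s`, up to the expected
second-order correction `η · selfIntersection`. -/
def crossingFactor (D R s η : ℝ) : ℝ :=
  Real.exp 1 / Real.cosh (s * (R - 1)) + η * (D * (1 + 4 * D * (R + 1)) * (R + 2) ^ 2)

/-- The majorant for slabs of width `R` when `φ k ≤ exp(-c k + η k²)`: the first term takes care
of the paths with `η * selfIntersection ≤ 1`, the second one of all others. -/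
def slabMajorant (X : G →+ ℝ) (D R s c η r : ℝ) (x : G) (C : G →₀ ℕ) : ℝ :=
  exitMajorant X R s c r x C + η * intersectionMajorant X D R r x C

lemma fieldWeight_le_slabMajorant (hφ : IsLocalWeight φ) (hD : 0 ≤ D) (hR : 1 ≤ R) (hη : 0 ≤ η)
    (hφc : ∀ k : ℕ, φ k ≤ Real.exp (-c * k + η * (k : ℝ) ^ 2))
    (hC : ∀ z ∈ C.support, X z ∈ Set.Ico r (r + R)) (hx : X x ∈ Set.Ico (r + R) (r + R + 1)) :
    fieldWeight φ C ≤ slabMajorant X D R s c η r x C := by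
  have hQ := mul_le_mul_of_nonneg_left
    (selfIntersection_le_intersectionMajorant hD hR hC hx.2) hη
  have hQ0 := mul_nonneg hη (selfIntersection_nonneg C)
  obtain h | h := le_total (η * selfIntersection C) 1
  · calc fieldWeight φ C ≤ Real.exp (-c * C.degree + η * selfIntersection C) :=
          fieldWeight_le_exp hφ hφc C
      _ ≤ Real.exp 1 * Real.exp (-c * C.degree) := by
          rw [← Real.exp_add]; exact Real.exp_le_exp.2 (by linarith)
      _ ≤ exitMajorant X R s c r x C := exp_le_exitMajorant_of_exit hR hx.1
      _ ≤ slabMajorant X D R s c η r x C := le_add_of_nonneg_right (hQ0.trans hQ)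
  · exact (hφ.fieldWeight_le_one C).trans <| h.trans <| hQ.trans <|
      le_add_of_nonneg_left exitMajorant_nonneg

lemma slabMajorant_le_crossingFactor (hD : 0 ≤ D) (hR : 1 ≤ R) (hη : 0 ≤ η)
    (hx : X x ∈ Set.Ico r (r + 1)) : slabMajorant X D R s c η r x 0 ≤ crossingFactor D R s η := by
  have hmax : max (X x - r - 1) 0 = 0 := max_eq_right (by linarith [hx.2])
  simp only [slabMajorant, exitMajorant, intersectionMajorant, crossingFactor, hmax, map_zero,
    selfIntersection, returnPotential, Finsupp.sum_zero_index, Nat.cast_zero, mul_zero,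
    Real.exp_zero, Real.cosh_zero, mul_one, zero_add]
  gcongr
  exact sub_le_self _ (sq_nonneg _)

lemma isSlabMajorant_slabMajorant [Nonempty A] (he : ∀ a, σ (e a) = -σ a)
    (h1 : ∀ a, |X (σ a)| ≤ 1) (hD : 0 ≤ D) (hvar : 1 ≤ D * 𝔼 a, X (σ a) ^ 2)
    (hφ : IsLocalWeight φ) (hR : 1 ≤ R) (hη : 0 ≤ η)
    (hφc : ∀ k : ℕ, φ k ≤ Real.exp (-c * k + η * (k : ℝ) ^ 2))
    (hc : 𝔼 a, Real.cosh (s * X (σ a)) ≤ Real.exp c) :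
    IsSlabMajorant σ φ X R (crossingFactor D R s η) (slabMajorant X D R s c η) := by
  have h0 : 𝔼 a, X (σ a) = 0 := expect_eq_zero_of_odd (e := e) fun a => by rw [he, map_neg]
  refine ⟨fun r x C hC hx => ?_, fun r x C _ hx => ?_, fun r x C _ hx => ?_,
    fun r x C hC hx => fieldWeight_le_slabMajorant hφ hD hR hη hφc hC hx,
    fun r x hx => slabMajorant_le_crossingFactor hD hR hη hx⟩
  · exact add_nonneg exitMajorant_nonneg <| mul_nonneg hη <| (selfIntersection_nonneg C).trans
      (selfIntersection_le_intersectionMajorant hD hR hC (by linarith))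
  · simp only [slabMajorant, Finset.expect_add_distrib, ← Finset.mul_expect]
    exact add_le_add (expect_exitMajorant_le_of_inside he hc) <| mul_le_mul_of_nonneg_left
      (expect_intersectionMajorant_le_of_inside h0 h1 hD hvar hR hx.1) hη
  · simp only [slabMajorant, Finset.expect_add_distrib, ← Finset.mul_expect]
    exact add_le_add (expect_exitMajorant_of_below h1 hx).le <| mul_le_mul_of_nonneg_left
      (expect_intersectionMajorant_le_of_below h0 hD hR) hη

end SlabMajorant

/-! ### Stable seminorms on abelian groups -/

lemma le_of_forall_nat_mul_le {s t D : ℝ} (h : ∀ k : ℕ, k * s ≤ k * t + D) : s ≤ t := by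
  by_contra! hlt
  obtain ⟨k, hk⟩ := exists_nat_gt (D / (s - t))
  rw [div_lt_iff₀ (sub_pos.2 hlt)] at hk
  linarith [h k]

section StableSeminorm

variable {G : Type*} [AddCommGroup G] (b : AddGroupSeminorm G)

lemma subadditive_nsmul (z : G) : Subadditive fun k : ℕ => b (k • z) := fun m n => by
  simpa only [add_smul] using map_add_le_add b (m • z) (n • z)

lemma tendsto_nsmul_div (z : G) :
    Tendsto (fun k : ℕ => b (k • z) / k) atTop (𝓝 (subadditive_nsmul b z).lim) :=
  (subadditive_nsmul b z).tendsto_lim ⟨0, by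
    rintro _ ⟨k, rfl⟩
    exact div_nonneg (apply_nonneg b _) k.cast_nonneg⟩

/-- The stable seminorm `z ↦ lim_{k → ∞} b(k z) / k`, the largest homogeneous seminorm below `b`. -/
def stableSeminorm : AddGroupSeminorm G where
  toFun z := (subadditive_nsmul b z).lim
  map_zero' := tendsto_nhds_unique (tendsto_nsmul_div b 0) (by simp)
  add_le' x y := le_of_tendsto_of_tendsto' (tendsto_nsmul_div b (x + y))
    ((tendsto_nsmul_div b x).add (tendsto_nsmul_div b y)) fun k => by
      rw [← add_div, smul_add]
      exact div_le_div_of_nonneg_right (map_add_le_add b _ _) k.cast_nonneg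
  neg' z := tendsto_nhds_unique (tendsto_nsmul_div b (-z))
    ((tendsto_nsmul_div b z).congr fun k => by rw [smul_neg, map_neg_eq_map])

lemma tendsto_stableSeminorm (z : G) :
    Tendsto (fun k : ℕ => b (k • z) / k) atTop (𝓝 (stableSeminorm b z)) :=
  tendsto_nsmul_div b z

lemma stableSeminorm_nsmul (m : ℕ) (z : G) :
    stableSeminorm b (m • z) = m * stableSeminorm b z := by
  obtain rfl | hm := m.eq_zero_or_pos
  · simp
  · refine tendsto_nhds_unique (tendsto_stableSeminorm b (m • z))
      ((((tendsto_stableSeminorm b z).comp (tendsto_id.atTop_mul_const' hm)).const_mul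
        (m : ℝ)).congr fun k => ?_)
    have hm' : (m : ℝ) ≠ 0 := Nat.cast_ne_zero.2 hm.ne'
    simp only [Function.comp_apply, id, Nat.cast_mul, ← mul_smul]
    rw [mul_div_assoc', mul_comm (m : ℝ), mul_div_mul_right _ _ hm']

variable {b}

lemma le_stableSeminorm {X : G →+ ℝ} {D : ℝ} (h : ∀ z, X z ≤ b z + D) (z : G) :
    X z ≤ stableSeminorm b z := by
  have hlim := (tendsto_stableSeminorm b z).add (tendsto_const_div_atTop_nhds_zero_nat D)
  rw [add_zero] at hlim
  refine ge_of_tendsto hlim ?_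
  filter_upwards [eventually_gt_atTop 0] with k hk
  rw [← add_div, le_div_iff₀ (Nat.cast_pos.2 hk), mul_comm, ← nsmul_eq_mul, ← map_nsmul]
  exact h _

lemma abs_le_stableSeminorm {X : G →+ ℝ} {D : ℝ} (h : ∀ z, X z ≤ b z + D) (z : G) :
    |X z| ≤ stableSeminorm b z :=
  abs_le'.2 ⟨le_stableSeminorm h z, by
    simpa only [map_neg_eq_map, map_neg] using le_stableSeminorm h (-z)⟩

end StableSeminorm

/-! ### Seminorms and lattices -/

section LatticeExtension

section InfConvolution

variable {E F : Type*} [AddCommGroup E] [Module ℝ E] [AddCommGroup F] [Module ℝ F]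
  (q : Seminorm ℝ F) (r : Seminorm ℝ E) (T : F →ₗ[ℝ] E)

lemma bddBelow_range_add_sub (x : E) : BddBelow (Set.range fun f => q f + r (x - T f)) :=
  ⟨0, by rintro _ ⟨f, rfl⟩; exact add_nonneg (apply_nonneg q _) (apply_nonneg r _)⟩

/-- The infimal convolution of `r` with the image of `q` under `T`: the least cost of
representing `x` as `T f`, at cost `q f`, up to an error measured by `r`. -/
def infConvolution : Seminorm ℝ E :=
  Seminorm.ofSMulLE (fun x => ⨅ f, (q f + r (x - T f)))
    (le_antisymm ((ciInf_le (bddBelow_range_add_sub q r T 0) 0).trans_eq (by simp))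
      (le_ciInf fun _ => add_nonneg (apply_nonneg q _) (apply_nonneg r _)))
    (fun x y => le_ciInf_add_ciInf fun f g =>
      (ciInf_le (bddBelow_range_add_sub q r T (x + y)) (f + g)).trans <| by
        rw [map_add T, add_sub_add_comm, add_add_add_comm]
        exact add_le_add (map_add_le_add q _ _) (map_add_le_add r _ _))
    (fun t x => by
      rw [Real.mul_iInf_of_nonneg (norm_nonneg t)]
      refine le_ciInf fun f =>
        (ciInf_le (bddBelow_range_add_sub q r T (t • x)) (t • f)).trans_eq ?_
      rw [map_smul T, ← smul_sub, map_smul_eq_mul, map_smul_eq_mul, mul_add])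

lemma infConvolution_le (x : E) (f : F) : infConvolution q r T x ≤ q f + r (x - T f) :=
  ciInf_le (bddBelow_range_add_sub q r T x) f

variable {q r T}

lemma le_infConvolution {c : ℝ} {x : E} (h : ∀ f, c ≤ q f + r (x - T f)) :
    c ≤ infConvolution q r T x :=
  le_ciInf h

end InfConvolution

variable {G E : Type*} [AddCommGroup G] [AddCommGroup E] [Module ℝ E] {b : AddGroupSeminorm G}
  {ι : G →+ E}

/-- The `ℓ¹` seminorm `f ↦ ∑ |f(z)| b(z)`. -/
def weightedL1 (b : AddGroupSeminorm G) : Seminorm ℝ (G →₀ ℝ) :=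
  Seminorm.of (fun f => f.sum fun z t => |t| * b z)
    (fun f g => by
      classical
      rw [Finsupp.sum_of_support_subset (f + g) Finsupp.support_add _ (by simp),
        Finsupp.sum_of_support_subset f (Finset.subset_union_left (s₂ := g.support)) _ (by simp),
        Finsupp.sum_of_support_subset g (Finset.subset_union_right (s₁ := f.support)) _ (by simp),
        ← Finset.sum_add_distrib]
      refine Finset.sum_le_sum fun z _ => ?_
      rw [← add_mul]
      exact mul_le_mul_of_nonneg_right (abs_add_le _ _) (apply_nonneg b z))
    (fun t f => by
      rw [Finsupp.sum_smul_index' (by simp), Finsupp.mul_sum]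
      simp only [smul_eq_mul, abs_mul, Real.norm_eq_abs, mul_assoc])

lemma weightedL1_eq_sum (f : G →₀ ℝ) {s : Finset G} (h : f.support ⊆ s) :
    weightedL1 b f = ∑ z ∈ s, |f z| * b z :=
  Finsupp.sum_of_support_subset f h (fun z t => |t| * b z) (by simp)

/-- The linear combination of the points of `s` with the integer parts of the coefficients `f`. -/
def floorCombination (s : Finset G) (f : G →₀ ℝ) : G := ∑ z ∈ s, ⌊f z⌋ • z

lemma map_zsmul_le (b : AddGroupSeminorm G) (m : ℤ) (z : G) : b (m • z) ≤ |(m : ℝ)| * b z := by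
  have hnat (n : ℕ) : b (n • z) ≤ n * b z := by
    simpa using Finset.le_sum_of_subadditive b (map_zero b).le (map_add_le_add b)
      (Finset.range n) fun _ => z
  obtain ⟨n, rfl | rfl⟩ := m.eq_nat_or_neg
  · simpa using hnat n
  · simpa [map_neg_eq_map] using hnat n

lemma map_floorCombination_le (b : AddGroupSeminorm G) {s : Finset G} {f : G →₀ ℝ}
    (h : f.support ⊆ s) : b (floorCombination s f) ≤ weightedL1 b f + ∑ z ∈ s, b z := by
  rw [weightedL1_eq_sum f h, ← Finset.sum_add_distrib]
  refine (Finset.le_sum_of_subadditive b (map_zero b).le (map_add_le_add b) _ _).trans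
    (Finset.sum_le_sum fun z _ => (map_zsmul_le b _ z).trans ?_)
  have hfloor : |(⌊f z⌋ : ℝ)| ≤ |f z| + 1 := by
    rw [← Int.self_sub_fract (f z)]
    refine (abs_sub _ _).trans (add_le_add_right ?_ _)
    rw [abs_of_nonneg (Int.fract_nonneg _)]
    exact (Int.fract_lt_one _).le
  calc |(⌊f z⌋ : ℝ)| * b z ≤ (|f z| + 1) * b z :=
        mul_le_mul_of_nonneg_right hfloor (apply_nonneg b z)
    _ = |f z| * b z + b z := by ring

lemma map_linearCombination_sub_floor_le (r : Seminorm ℝ E) (ι : G →+ E) {s : Finset G}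
    {f : G →₀ ℝ} (h : f.support ⊆ s) :
    r (Finsupp.linearCombination ℝ ι f - ι (floorCombination s f)) ≤ ∑ z ∈ s, r (ι z) := by
  have hfract : Finsupp.linearCombination ℝ ι f - ι (floorCombination s f) =
      ∑ z ∈ s, Int.fract (f z) • ι z := by
    rw [Finsupp.linearCombination_apply, Finsupp.sum_of_support_subset f h _ (by simp)]
    simp only [floorCombination, map_sum, map_zsmul, Int.fract, sub_smul, Int.cast_smul_eq_zsmul,
      Finset.sum_sub_distrib]
  rw [hfract]
  refine (Finset.le_sum_of_subadditive r (map_zero r).le (map_add_le_add r) _ _).trans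
    (Finset.sum_le_sum fun z _ => ?_)
  rw [map_smul_eq_mul, Real.norm_eq_abs, abs_of_nonneg (Int.fract_nonneg _)]
  exact mul_le_of_le_one_left (apply_nonneg r _) (Int.fract_lt_one _).le

lemma seminorm_le_of_le_on_lattice {p q : Seminorm ℝ E}
    (hι : Submodule.span ℝ (Set.range ι) = ⊤) (h : ∀ z, p (ι z) ≤ q (ι z)) : p ≤ q := by
  intro x
  obtain ⟨f, rfl⟩ := Finsupp.mem_span_range_iff_exists_finsupp.1
    (hι.symm ▸ Submodule.mem_top : x ∈ Submodule.span ℝ (Set.range ι))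
  rw [← Finsupp.linearCombination_apply]
  set x := Finsupp.linearCombination ℝ ι f
  refine le_of_forall_nat_mul_le
    (D := ∑ z ∈ f.support, p (ι z) + ∑ z ∈ f.support, q (ι z)) fun k => ?_
  have hsupp : ((k : ℝ) • f).support ⊆ f.support := Finsupp.support_smul
  have hsmul (p : Seminorm ℝ E) : p ((k : ℝ) • x) = k * p x := by
    rw [map_smul_eq_mul, Real.norm_natCast]
  have herr (p : Seminorm ℝ E) := map_linearCombination_sub_floor_le p ι hsupp
  simp only [map_smul] at herr
  set u := floorCombination f.support ((k : ℝ) • f)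
  have hp : p ((k : ℝ) • x) ≤ p (ι u) + p ((k : ℝ) • x - ι u) := by
    simpa using map_add_le_add p (ι u) ((k : ℝ) • x - ι u)
  have hq : q (ι u) ≤ q ((k : ℝ) • x) + q ((k : ℝ) • x - ι u) := by
    simpa using map_sub_le_add q ((k : ℝ) • x) ((k : ℝ) • x - ι u)
  rw [hsmul] at hp hq
  linarith [herr p, herr q, h u]

lemma seminorm_eq_of_eq_on_lattice {p q : Seminorm ℝ E}
    (hι : Submodule.span ℝ (Set.range ι) = ⊤) (h : ∀ z, p (ι z) = q (ι z)) : p = q :=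
  le_antisymm (seminorm_le_of_le_on_lattice hι fun z => (h z).le)
    (seminorm_le_of_le_on_lattice hι fun z => (h z).ge)

lemma le_weightedL1_add (hsmul : ∀ (m : ℕ) z, b (m • z) = m * b z) {r : Seminorm ℝ E}
    (hr : ∀ z, b z ≤ r (ι z)) (w : G) (f : G →₀ ℝ) :
    b w ≤ weightedL1 b f + r (ι w - Finsupp.linearCombination ℝ ι f) := by
  set T := Finsupp.linearCombination ℝ ι
  refine le_of_forall_nat_mul_le
    (D := ∑ z ∈ f.support, b z + ∑ z ∈ f.support, r (ι z)) fun k => ?_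
  have hsupp : ((k : ℝ) • f).support ⊆ f.support := Finsupp.support_smul
  set u := floorCombination f.support ((k : ℝ) • f)
  have hu : b u ≤ k * weightedL1 b f + ∑ z ∈ f.support, b z := by
    simpa [map_smul_eq_mul] using map_floorCombination_le b hsupp
  have herr : r ((k : ℝ) • (ι w - T f) + (T ((k : ℝ) • f) - ι u)) ≤
      k * r (ι w - T f) + ∑ z ∈ f.support, r (ι z) := by
    refine (map_add_le_add r _ _).trans
      (add_le_add ?_ (map_linearCombination_sub_floor_le r ι hsupp))
    rw [map_smul_eq_mul, Real.norm_natCast]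
  have hrest : ι (k • w - u) = (k : ℝ) • (ι w - T f) + (T ((k : ℝ) • f) - ι u) := by
    rw [map_sub, map_nsmul, map_smul, smul_sub, Nat.cast_smul_eq_nsmul, Nat.cast_smul_eq_nsmul]
    abel
  calc k * b w = b (k • w) := (hsmul k w).symm
    _ ≤ b u + b (k • w - u) := by simpa using map_add_le_add b u (k • w - u)
    _ ≤ b u + r ((k : ℝ) • (ι w - T f) + (T ((k : ℝ) • f) - ι u)) := by
        rw [← hrest]; gcongr; exact hr _
    _ ≤ _ := by linarith

/-- The extension of a homogeneous seminorm on a lattice that is dominated by `r`. -/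
def latticeExtension (b : AddGroupSeminorm G) (ι : G →+ E) (r : Seminorm ℝ E) : Seminorm ℝ E :=
  infConvolution (weightedL1 b) r (Finsupp.linearCombination ℝ ι)

lemma latticeExtension_apply (hsmul : ∀ (m : ℕ) z, b (m • z) = m * b z) {r : Seminorm ℝ E}
    (hr : ∀ z, b z ≤ r (ι z)) (z : G) : latticeExtension b ι r (ι z) = b z := by
  refine le_antisymm ((infConvolution_le _ _ _ _ (Finsupp.single z 1)).trans_eq ?_)
    (le_infConvolution (le_weightedL1_add hsmul hr z))
  simp [weightedL1_eq_sum _ Finsupp.support_single_subset]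

end LatticeExtension

/-! ### The cost of reaching a point -/

section SurvivalCost

variable {G A : Type*} [AddCommGroup G] [Fintype A] {σ : A → G} {φ : ℕ → ℝ} {e : A ≃ A}

/-- The annealed survival function `𝔼[e(0, y, V)]` of the walk with steps uniform in `σ`, as a
function of the local weight `φ k = 𝔼[exp(-k V(0))]`. -/
def annealedSurvival (σ : A → G) (φ : ℕ → ℝ) (y : G) : ℝ := ⨆ n, annealed σ φ y n 0 0

lemma annealedSurvival_zero : annealedSurvival σ φ 0 = 1 := by
  simp [annealedSurvival, annealed_self]

lemma annealedSurvival_neg (he : ∀ a, σ (e a) = -σ a) (y : G) :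
    annealedSurvival σ φ (-y) = annealedSurvival σ φ y := by
  simp only [annealedSurvival, annealed_neg he]

namespace IsLocalWeight

variable [Nonempty A]

lemma bddAbove_range_annealed (hφ : IsLocalWeight φ) (y : G) :
    BddAbove (Set.range fun n => annealed σ φ y n 0 0) :=
  ⟨1, by rintro _ ⟨n, rfl⟩; exact hφ.annealed_le_one n 0 0⟩

lemma tendsto_annealed (hφ : IsLocalWeight φ) (y : G) :
    Tendsto (fun n => annealed σ φ y n 0 0) atTop (𝓝 (annealedSurvival σ φ y)) :=
  tendsto_atTop_ciSup (hφ.annealed_monotone 0 0) (hφ.bddAbove_range_annealed y)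

lemma annealed_le_annealedSurvival (hφ : IsLocalWeight φ) (n : ℕ) (y : G) :
    annealed σ φ y n 0 0 ≤ annealedSurvival σ φ y :=
  le_ciSup (hφ.bddAbove_range_annealed y) n

lemma annealedSurvival_mul_le (hφ : IsLocalWeight φ) (x y : G) :
    annealedSurvival σ φ x * annealedSurvival σ φ y ≤ annealedSurvival σ φ (x + y) := by
  refine le_of_tendsto' ((hφ.tendsto_annealed x).mul (hφ.tendsto_annealed y)) fun n => ?_
  have hmul := hφ.annealed_mul_le (σ := σ) (y := x) (z := x + y) n n 0 0
  have hshift := annealed_add_left (σ := σ) (φ := φ) (y := y) x n 0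
  rw [add_zero] at hshift
  rw [hshift] at hmul
  exact hmul.trans (hφ.annealed_le_annealedSurvival (n + n) (x + y))

lemma annealedSurvival_step_pos (hφ : IsLocalWeight φ) (a : A) :
    0 < annealedSurvival σ φ (σ a) := by
  obtain h | h := eq_or_ne 0 (σ a)
  · rw [← h, annealedSurvival_zero]
    exact one_pos
  · refine lt_of_lt_of_le ?_ (hφ.annealed_le_annealedSurvival 1 (σ a))
    rw [annealed_succ_of_ne h]
    refine Finset.expect_pos' (fun b _ => hφ.annealed_nonneg _ _ _) ⟨a, Finset.mem_univ a, ?_⟩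
    rw [zero_add, annealed_self]
    exact hφ.fieldWeight_pos _

lemma annealedSurvival_pos (hφ : IsLocalWeight φ) (he : ∀ a, σ (e a) = -σ a) {y : G}
    (hy : y ∈ AddSubgroup.closure (Set.range σ)) : 0 < annealedSurvival σ φ y := by
  induction hy using AddSubgroup.closure_induction with
  | mem y hy => obtain ⟨a, rfl⟩ := hy; exact hφ.annealedSurvival_step_pos a
  | zero => rw [annealedSurvival_zero]; exact one_pos
  | add x y _ _ hx hy => exact (mul_pos hx hy).trans_le (hφ.annealedSurvival_mul_le x y)
  | neg x _ hx => rwa [annealedSurvival_neg he]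

/-- The cost `-ln 𝔼[e(0, y, V)]` of reaching `y`, for a symmetric walk that visits all of `G`. -/
def survivalCost (hφ : IsLocalWeight φ) (he : ∀ a, σ (e a) = -σ a)
    (hσ : AddSubgroup.closure (Set.range σ) = ⊤) : AddGroupSeminorm G where
  toFun y := -Real.log (annealedSurvival σ φ y)
  map_zero' := by rw [annealedSurvival_zero, Real.log_one, neg_zero]
  add_le' x y := by
    have hpos (z : G) : 0 < annealedSurvival σ φ z :=
      hφ.annealedSurvival_pos he (hσ ▸ AddSubgroup.mem_top z)
    rw [← neg_add, neg_le_neg_iff, ← Real.log_mul (hpos x).ne' (hpos y).ne']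
    exact Real.log_le_log (mul_pos (hpos x) (hpos y)) (hφ.annealedSurvival_mul_le x y)
  neg' y := by rw [annealedSurvival_neg he]

lemma survivalCost_apply (hφ : IsLocalWeight φ) (he : ∀ a, σ (e a) = -σ a)
    (hσ : AddSubgroup.closure (Set.range σ) = ⊤) (y : G) :
    hφ.survivalCost he hσ y = -Real.log (annealedSurvival σ φ y) := rfl

end IsLocalWeight

variable [Nonempty A] {X : G →+ ℝ} {R ρ t : ℝ} {Ψ : ℝ → G → (G →₀ ℕ) → ℝ}

lemma IsSlabMajorant.mul_le_survivalCost_add (hΨ : IsSlabMajorant σ φ X R ρ Ψ)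
    (hφ : IsLocalWeight φ) (he : ∀ a, σ (e a) = -σ a)
    (hσ : AddSubgroup.closure (Set.range σ) = ⊤) (hX : ∀ a, X (σ a) ≤ 1) (hR : 1 ≤ R)
    (ht : 0 ≤ t) (hρ : ρ ≤ Real.exp (-(t * R))) (z : G) :
    t * X z ≤ hφ.survivalCost he hσ z + t * R := by
  have hR0 : 0 < R := one_pos.trans_le hR
  obtain hz | hz := le_total (X z) 0
  · exact (mul_nonpos_of_nonneg_of_nonpos ht hz).trans
      (add_nonneg (apply_nonneg _ z) (mul_nonneg ht hR0.le))
  set j := ⌊X z / R⌋₊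
  have hj : j * R ≤ X z := (le_div_iff₀ hR0).1 (Nat.floor_le (div_nonneg hz hR0.le))
  have hj' : X z ≤ (j + 1) * R := (div_le_iff₀ hR0).1 (Nat.lt_floor_add_one _).le
  have hsurvival : annealedSurvival σ φ z ≤ Real.exp (-(t * R) * j) := by
    rw [mul_comm, Real.exp_nat_mul]
    exact ciSup_le fun n => (hΨ.annealed_le_pow hφ hX hR n j hj).trans
      (pow_le_pow_left₀ (hΨ.start_nonneg hR) hρ j)
  have hlog := (Real.log_le_iff_le_exp
    (hφ.annealedSurvival_pos he (hσ ▸ AddSubgroup.mem_top z))).2 hsurvival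
  rw [hφ.survivalCost_apply]
  linarith [mul_le_mul_of_nonneg_left hj' ht]

lemma IsSlabMajorant.mul_abs_le_stableSeminorm (hΨ : IsSlabMajorant σ φ X R ρ Ψ)
    (hφ : IsLocalWeight φ) (he : ∀ a, σ (e a) = -σ a)
    (hσ : AddSubgroup.closure (Set.range σ) = ⊤) (hX : ∀ a, X (σ a) ≤ 1) (hR : 1 ≤ R)
    (ht : 0 ≤ t) (hρ : ρ ≤ Real.exp (-(t * R))) (z : G) :
    t * |X z| ≤ stableSeminorm (hφ.survivalCost he hσ) z := by
  have h := abs_le_stableSeminorm (X := (AddMonoidHom.mulLeft t).comp X)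
    (hΨ.mul_le_survivalCost_add hφ he hσ hX hR ht hρ) z
  rwa [AddMonoidHom.comp_apply, AddMonoidHom.coe_mulLeft, abs_mul, abs_of_nonneg ht] at h

end SurvivalCost

/-! ### The annealed exponent of the simple random walk -/

section AnnealedExponent

variable {d : ℕ} {φ : ℕ → ℝ}

/-- The involution of the set of steps that reverses the direction. -/
def reverseStep : Fin d × Bool ≃ Fin d × Bool := (Equiv.refl _).prodCongr Equiv.boolNot

lemma step_reverseStep (a : Fin d × Bool) : step (reverseStep a) = -step a := by
  obtain ⟨i, b⟩ := a
  cases b <;> simp [reverseStep, step, ← Pi.single_neg]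

lemma sum_smul_single_one (z : Fin d → ℤ) : ∑ i, z i • (Pi.single i 1 : Fin d → ℤ) = z := by
  simpa using (Pi.basisFun ℤ (Fin d)).sum_repr z

lemma closure_range_step : AddSubgroup.closure (Set.range (step (d := d))) = ⊤ :=
  (AddSubgroup.eq_top_iff' _).2 fun z => by
    rw [← sum_smul_single_one z]
    refine sum_mem fun i _ => zsmul_mem (AddSubgroup.subset_closure ?_) _
    exact ⟨(i, true), rfl⟩

/-- `toEuclidean` as an additive map. -/
def toEuclideanHom : (Fin d → ℤ) →+ EuclideanSpace ℝ (Fin d) :=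
  AddMonoidHom.mk' toEuclidean fun x y => by ext i; simp [toEuclidean]

lemma toEuclideanHom_apply (z : Fin d → ℤ) : toEuclideanHom z = toEuclidean z := rfl

lemma toEuclidean_single (i : Fin d) (m : ℤ) :
    toEuclidean (Pi.single i m) = EuclideanSpace.single i (m : ℝ) := by
  ext j
  obtain rfl | h := eq_or_ne j i <;> simp [toEuclidean, *]

lemma span_range_toEuclideanHom :
    Submodule.span ℝ (Set.range (toEuclideanHom (d := d))) = ⊤ := by
  rw [eq_top_iff, ← (EuclideanSpace.basisFun (Fin d) ℝ).toBasis.span_eq, Submodule.span_le]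
  rintro _ ⟨i, rfl⟩
  exact Submodule.subset_span ⟨Pi.single i 1, by simp [toEuclideanHom_apply, toEuclidean_single]⟩

lemma le_sum_mul_norm_toEuclidean (b : AddGroupSeminorm (Fin d → ℤ)) (z : Fin d → ℤ) :
    b z ≤ (∑ i, b (Pi.single i 1)) * ‖toEuclidean z‖ := by
  conv_lhs => rw [← sum_smul_single_one z]
  refine (Finset.le_sum_of_subadditive b (map_zero b).le (map_add_le_add b) _ _).trans ?_
  rw [Finset.sum_mul]
  refine Finset.sum_le_sum fun i _ => (map_zsmul_le b _ _).trans ?_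
  rw [mul_comm]
  exact mul_le_mul_of_nonneg_left
    (by simpa [toEuclidean] using PiLp.norm_apply_le (toEuclidean z) i) (apply_nonneg b _)

/-- The extension of a homogeneous seminorm on `ℤ^d` to a seminorm on `ℝ^d`. -/
def euclideanExtension (b : AddGroupSeminorm (Fin d → ℤ)) : Seminorm ℝ (EuclideanSpace ℝ (Fin d)) :=
  latticeExtension b toEuclideanHom
    ((∑ i, b (Pi.single i 1)).toNNReal • normSeminorm ℝ (EuclideanSpace ℝ (Fin d)))

lemma euclideanExtension_toEuclidean {b : AddGroupSeminorm (Fin d → ℤ)}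
    (hb : ∀ (m : ℕ) z, b (m • z) = m * b z) (z : Fin d → ℤ) :
    euclideanExtension b (toEuclidean z) = b z := by
  refine latticeExtension_apply hb (fun z => (le_sum_mul_norm_toEuclidean b z).trans_eq ?_) z
  rw [smul_apply, NNReal.smul_def,
    Real.coe_toNNReal _ (Finset.sum_nonneg fun i _ => apply_nonneg b _)]
  rfl

variable [NeZero d]

/-- The annealed Lyapunov exponent of the potentials with `φ k = 𝔼[exp(-k V(0))]`. -/
def annealedExponent (hφ : IsLocalWeight φ) : Seminorm ℝ (EuclideanSpace ℝ (Fin d)) :=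
  euclideanExtension (stableSeminorm (hφ.survivalCost step_reverseStep closure_range_step))

lemma annealedExponent_toEuclidean (hφ : IsLocalWeight φ) (z : Fin d → ℤ) :
    annealedExponent hφ (toEuclidean z) =
      stableSeminorm (hφ.survivalCost step_reverseStep closure_range_step) z :=
  euclideanExtension_toEuclidean (stableSeminorm_nsmul _) z

lemma tendsto_annealedExponent (hφ : IsLocalWeight φ) (z : Fin d → ℤ) :
    Tendsto (fun k : ℕ => -1 / (k : ℝ) * Real.log (annealedSurvival step φ (k • z))) atTop
      (𝓝 (annealedExponent hφ (toEuclidean z))) := by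
  rw [annealedExponent_toEuclidean]
  refine (tendsto_stableSeminorm _ z).congr fun k => ?_
  rw [hφ.survivalCost_apply]
  ring

end AnnealedExponent

/-! ### Lower bounds for the annealed exponent -/

section LowerBounds

variable {d : ℕ} {φ : ℕ → ℝ} {θ : EuclideanSpace ℝ (Fin d)}

/-- The projection of the lattice to the direction `θ`. -/
def projection (θ : EuclideanSpace ℝ (Fin d)) : (Fin d → ℤ) →+ ℝ :=
  (innerSL ℝ θ).toLinearMap.toAddMonoidHom.comp toEuclideanHom

lemma projection_step (θ : EuclideanSpace ℝ (Fin d)) (a : Fin d × Bool) :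
    projection θ (step a) = if a.2 then θ a.1 else -θ a.1 := by
  change inner ℝ θ (toEuclidean (step a)) = _
  rw [step, toEuclidean_single, EuclideanSpace.inner_single_right]
  split_ifs <;> simp

lemma abs_projection_step_le (hθ : ‖θ‖ = 1) (a : Fin d × Bool) : |projection θ (step a)| ≤ 1 := by
  have h := PiLp.norm_apply_le θ a.1
  rw [hθ, Real.norm_eq_abs] at h
  rw [projection_step]
  split_ifs
  · exact h
  · rwa [abs_neg]

lemma expect_sq_projection_step (hθ : ‖θ‖ = 1) :
    𝔼 a, projection θ (step a) ^ 2 = (d : ℝ)⁻¹ := by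
  have h : ∑ i, θ i ^ 2 = 1 := by rw [← EuclideanSpace.real_norm_sq_eq, hθ, one_pow]
  have hsum : ∑ a, projection θ (step a) ^ 2 = 2 := by
    simp only [projection_step, Fintype.sum_prod_type, Fintype.sum_bool, if_true,
      Bool.false_eq_true, if_false, neg_sq, Finset.sum_add_distrib, h]
    norm_num
  rw [Fintype.expect_eq_sum_div_card, hsum, Fintype.card_prod, Fintype.card_fin, Fintype.card_bool]
  push_cast
  rw [div_mul_cancel_right₀ two_ne_zero]

variable [NeZero d]

lemma mul_norm_le_annealedExponent (hφ : IsLocalWeight φ) {R ρ t : ℝ} (hR : 1 ≤ R) (ht : 0 ≤ t)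
    (hρ : ρ ≤ Real.exp (-(t * R)))
    (hΨ : ∀ θ : EuclideanSpace ℝ (Fin d), ‖θ‖ = 1 →
      ∃ Ψ, IsSlabMajorant step φ (projection θ) R ρ Ψ) (ℓ : EuclideanSpace ℝ (Fin d)) :
    t * ‖ℓ‖ ≤ annealedExponent hφ ℓ := by
  obtain rfl | hℓ := eq_or_ne ℓ 0
  · simp
  set θ := ‖ℓ‖⁻¹ • ℓ
  have hθ : ‖θ‖ = 1 := by simp [θ, norm_smul, norm_ne_zero_iff.2 hℓ]
  obtain ⟨Ψ, h⟩ := hΨ θ hθ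
  let q : Seminorm ℝ (EuclideanSpace ℝ (Fin d)) :=
    t.toNNReal • (normSeminorm ℝ ℝ).comp (innerSL ℝ θ).toLinearMap
  have hq (x) : q x = t * |inner ℝ θ x| := by
    simp [q, NNReal.smul_def, ht]
  have hle : q ≤ annealedExponent hφ :=
    seminorm_le_of_le_on_lattice span_range_toEuclideanHom fun z => by
      rw [hq, toEuclideanHom_apply, annealedExponent_toEuclidean]
      exact h.mul_abs_le_stableSeminorm hφ _ _ (fun a => (abs_le.1 (abs_projection_step_le hθ a)).2)
        hR ht hρ z
  have hinner : inner ℝ θ ℓ = ‖ℓ‖ := by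
    rw [real_inner_smul_left, real_inner_self_eq_norm_sq, sq, inv_mul_cancel_left₀]
    exact norm_ne_zero_iff.2 hℓ
  simpa only [hq, hinner, abs_norm] using hle ℓ

lemma neg_log_mul_norm_le_annealedExponent (hφ : IsLocalWeight φ)
    (ℓ : EuclideanSpace ℝ (Fin d)) : -Real.log (φ 1) * ‖ℓ‖ ≤ annealedExponent hφ ℓ :=
  mul_norm_le_annealedExponent hφ le_rfl
    (neg_nonneg.2 (Real.log_nonpos (hφ.pos 1).le (hφ.le_one 1)))
    (by rw [mul_one, neg_neg, Real.exp_log (hφ.pos 1)])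
    (fun _ hθ => ⟨_, isSlabMajorant_visitMajorant hφ
      fun a => (abs_le.1 (abs_projection_step_le hθ a)).2⟩) ℓ

lemma annealedExponent_pos (hφ : IsLocalWeight φ) (h : φ 1 < 1) {ℓ : EuclideanSpace ℝ (Fin d)}
    (hℓ : ℓ ≠ 0) : 0 < annealedExponent hφ ℓ :=
  (mul_pos (neg_pos.2 (Real.log_neg (hφ.pos 1) h)) (norm_pos_iff.2 hℓ)).trans_le
    (neg_log_mul_norm_le_annealedExponent hφ ℓ)

lemma expect_cosh_mul_le_exp {A : Type*} [Fintype A] [Nonempty A] {ξ : A → ℝ}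
    (h1 : ∀ a, |ξ a| ≤ 1) {s c : ℝ} (hs : s ^ 2 ≤ 2)
    (hc : s ^ 2 / 2 * (1 + s ^ 2 / 2) * 𝔼 a, ξ a ^ 2 ≤ c) :
    𝔼 a, Real.cosh (s * ξ a) ≤ Real.exp c := by
  have hcosh (a : A) : Real.cosh (s * ξ a) ≤ 1 + s ^ 2 / 2 * (1 + s ^ 2 / 2) * ξ a ^ 2 := by
    set u := (s * ξ a) ^ 2 / 2 with hu
    have hu0 : 0 ≤ u := by positivity
    have hus : u ≤ s ^ 2 / 2 := by
      rw [hu, mul_pow]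
      have hξ : ξ a ^ 2 ≤ 1 := (sq_le_one_iff_abs_le_one _).2 (h1 a)
      linarith [mul_le_of_le_one_right (sq_nonneg s) hξ]
    have hexp := (abs_le.1 (Real.abs_exp_sub_one_sub_id_le
      (show |u| ≤ 1 by rw [abs_of_nonneg hu0]; linarith))).2
    calc Real.cosh (s * ξ a) ≤ Real.exp u := Real.cosh_le_exp_half_sq _
      _ ≤ 1 + u + u ^ 2 := by linarith
      _ ≤ 1 + u + s ^ 2 / 2 * u := by
          rw [sq u]; linarith [mul_le_mul_of_nonneg_right hus hu0]
      _ = _ := by rw [hu]; ring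
  calc 𝔼 a, Real.cosh (s * ξ a)
      ≤ 𝔼 a, (1 + s ^ 2 / 2 * (1 + s ^ 2 / 2) * ξ a ^ 2) :=
        Finset.expect_le_expect fun a _ => hcosh a
    _ = s ^ 2 / 2 * (1 + s ^ 2 / 2) * (𝔼 a, ξ a ^ 2) + 1 := by
        rw [Finset.expect_add_distrib, Fintype.expect_const, ← Finset.mul_expect, add_comm]
    _ ≤ Real.exp c := (add_le_add_left hc 1).trans (Real.add_one_le_exp c)

end LowerBounds

/-! ### The first step of the walk -/

lemma integral_toMeasure_uniformOfFintype {A : Type*} [Fintype A] [Nonempty A]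
    [MeasurableSpace A] [MeasurableSingletonClass A] (f : A → ℝ) :
    ∫ a, f a ∂(PMF.uniformOfFintype A).toMeasure = 𝔼 a, f a := by
  simp [PMF.integral_eq_sum, Finset.expect_eq_sum_div_card, div_eq_inv_mul, Finset.mul_sum]

lemma map_head_tail_infinitePi {A : Type*} [MeasurableSpace A] (μ : Measure A)
    [IsProbabilityMeasure μ] :
    (Measure.infinitePi fun _ : ℕ => μ).map (fun s => (s 0, fun n => s (n + 1))) =
      μ.prod (Measure.infinitePi fun _ => μ) := by
  have hind : IndepFun (fun s : ℕ → A => s 0) (fun s n => s (n + 1))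
      (Measure.infinitePi fun _ : ℕ => μ) := by
    have hcoord := indep_iSup_of_disjoint (fun n => (measurable_pi_apply n).comap_le)
      (iIndepFun_infinitePi (P := fun _ : ℕ => μ) (X := fun _ a => a) fun _ => measurable_id).iIndep
      (disjoint_compl_right (a := ({0} : Set ℕ)))
    refine indep_of_indep_of_le_right (indep_of_indep_of_le_left hcoord ?_) ?_
    · exact le_iSup₂_of_le 0 rfl le_rfl
    · rw [MeasurableSpace.pi, MeasurableSpace.comap_iSup]
      refine iSup_le fun n => ?_
      rw [MeasurableSpace.comap_comp]
      exact le_iSup₂_of_le (n + 1) (Nat.succ_ne_zero n) le_rfl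
  rw [IndepFun.map_prod_eq_prod_map_map (measurable_pi_apply 0).aemeasurable
      (measurable_pi_lambda _ fun n => measurable_pi_apply (n + 1)).aemeasurable hind,
    Measure.infinitePi_map_eval,
    Measure.map_infinitePi_infinitePi_of_inj (P := fun _ : ℕ => μ) Nat.succ_injective]

variable {d : ℕ}

instance [NeZero d] : IsProbabilityMeasure (walkMeasure d) :=
  inferInstanceAs (IsProbabilityMeasure (Measure.infinitePi _))

lemma integral_walkMeasure [NeZero d] {F : (Fin d × Bool) × (ℕ → Fin d × Bool) → ℝ}
    (hF : Measurable F) {c : ℝ} (hc : ∀ p, ‖F p‖ ≤ c) :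
    ∫ s, F (s 0, fun n => s (n + 1)) ∂walkMeasure d = 𝔼 a, ∫ s, F (a, s) ∂walkMeasure d := by
  have hmeas : Measurable fun s : ℕ → Fin d × Bool => (s 0, fun n => s (n + 1)) := by fun_prop
  rw [← integral_toMeasure_uniformOfFintype, walkMeasure,
    ← integral_map hmeas.aemeasurable hF.aestronglyMeasurable, map_head_tail_infinitePi,
    integral_prod _ (.of_bound hF.aestronglyMeasurable c (.of_forall hc))]

lemma walk_zero (s : ℕ → Fin d × Bool) : walk s 0 = 0 := Finset.sum_range_zero _

lemma walk_succ_eq_step_add (s : ℕ → Fin d × Bool) (n : ℕ) :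
    walk s (n + 1) = step (s 0) + walk (fun k => s (k + 1)) n := by
  rw [walk, Finset.sum_range_succ', add_comm, walk]

/-! ### The quenched walk -/

/-- The weight `exp(-∑ v(S(k)))`, summed up to the first visit of `y`, of the walk `S` from `x`
with steps `s`; it is `0` if `S` does not visit `y` within `n` steps. -/
def pathWeight (v : (Fin d → ℤ) → ℝ) (y : Fin d → ℤ) :
    ℕ → (Fin d → ℤ) → (ℕ → Fin d × Bool) → ℝ
  | 0, x, _ => if x = y then 1 else 0
  | n + 1, x, s => if x = y then 1 else
      Real.exp (-v x) * pathWeight v y n (x + step (s 0)) fun k => s (k + 1)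

/-- The contribution to `e(x, y, v)` of the paths that reach `y` within `n` steps. -/
def quenched (v : (Fin d → ℤ) → ℝ) (y : Fin d → ℤ) : ℕ → (Fin d → ℤ) → ℝ
  | 0, x => if x = y then 1 else 0
  | n + 1, x => if x = y then 1 else
      Real.exp (-v x) * 𝔼 a, quenched v y n (x + step a)

variable {v : (Fin d → ℤ) → ℝ} {x y : Fin d → ℤ} {n m : ℕ} {s : ℕ → Fin d × Bool}

lemma pathWeight_self : pathWeight v y n y s = 1 := by
  cases n <;> simp [pathWeight]

lemma pathWeight_succ_of_ne (h : x ≠ y) :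
    pathWeight v y (n + 1) x s =
      Real.exp (-v x) * pathWeight v y n (x + step (s 0)) fun k => s (k + 1) := by
  simp [pathWeight, h]

lemma pathWeight_eq_zero (h : ∀ m ≤ n, x + walk s m ≠ y) : pathWeight v y n x s = 0 := by
  have hx : x ≠ y := by simpa [walk_zero] using h 0 (Nat.zero_le n)
  induction n generalizing x s with
  | zero => simp [pathWeight, hx]
  | succ n ih =>
    have htail (m : ℕ) (hm : m ≤ n) : x + step (s 0) + walk (fun k => s (k + 1)) m ≠ y := by
      simpa [walk_succ_eq_step_add, add_assoc] using h (m + 1) (Nat.succ_le_succ hm)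
    rw [pathWeight_succ_of_ne hx, ih htail, mul_zero]
    simpa [walk_zero] using htail 0 (Nat.zero_le n)

lemma pathWeight_eq_exp (hmn : m ≤ n) (hm : x + walk s m = y)
    (hlt : ∀ k < m, x + walk s k ≠ y) :
    pathWeight v y n x s = Real.exp (-∑ k ∈ Finset.range m, v (x + walk s k)) := by
  induction m generalizing n x s with
  | zero => simp [show x = y by simpa [walk_zero] using hm, pathWeight_self]
  | succ m ih =>
    obtain ⟨n, rfl⟩ := Nat.exists_eq_add_of_le' (Nat.one_le_of_lt hmn)
    have hx : x ≠ y := by simpa [walk_zero] using hlt 0 m.succ_pos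
    have htail (k : ℕ) :
        x + walk s (k + 1) = x + step (s 0) + walk (fun k => s (k + 1)) k := by
      rw [walk_succ_eq_step_add, add_assoc]
    rw [pathWeight_succ_of_ne hx, ih (Nat.le_of_succ_le_succ hmn) (htail m ▸ hm)
      fun k hk => htail k ▸ hlt (k + 1) (Nat.succ_lt_succ hk), ← Real.exp_add,
      Finset.sum_range_succ']
    simp only [htail, walk_zero, add_zero, neg_add_rev]

lemma measurable_pathWeight : Measurable (pathWeight v y n x) := by
  induction n generalizing x with
  | zero => exact measurable_const
  | succ n ih =>
    have htail : Measurable fun s : ℕ → Fin d × Bool => (s 0, fun k => s (k + 1)) := by fun_prop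
    have hstep : Measurable fun p : (Fin d × Bool) × (ℕ → Fin d × Bool) =>
        pathWeight v y n (x + step p.1) p.2 := measurable_from_prod_countable_right fun a =>
          ih (x := x + step a)
    exact .ite (.const _) measurable_const ((hstep.comp htail).const_mul _)

lemma pathWeight_nonneg : 0 ≤ pathWeight v y n x s := by
  induction n generalizing x s with
  | zero => rw [pathWeight]; split_ifs; exacts [zero_le_one, le_rfl]
  | succ n ih => rw [pathWeight]; split_ifs; exacts [zero_le_one, mul_nonneg (Real.exp_nonneg _) ih]

lemma norm_pathWeight_le_one (hv : ∀ x, 0 ≤ v x) : ‖pathWeight v y n x s‖ ≤ 1 := by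
  rw [Real.norm_of_nonneg pathWeight_nonneg]
  induction n generalizing x s with
  | zero => rw [pathWeight]; split_ifs; exacts [le_rfl, zero_le_one]
  | succ n ih =>
    rw [pathWeight]; split_ifs
    exacts [le_rfl, mul_le_one₀ (Real.exp_le_one_iff.2 (neg_nonpos.2 (hv x))) pathWeight_nonneg ih]

lemma quenched_self : quenched v y n y = 1 := by
  cases n <;> simp [quenched]

lemma quenched_succ_of_ne (h : x ≠ y) :
    quenched v y (n + 1) x = Real.exp (-v x) * 𝔼 a, quenched v y n (x + step a) := by
  simp [quenched, h]

lemma integral_pathWeight [NeZero d] (hv : ∀ x, 0 ≤ v x) :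
    ∫ s, pathWeight v y n x s ∂walkMeasure d = quenched v y n x := by
  induction n generalizing x with
  | zero => simp [pathWeight, quenched]
  | succ n ih =>
    obtain rfl | h := eq_or_ne x y
    · simp [pathWeight_self, quenched_self]
    · simp only [pathWeight_succ_of_ne h, integral_const_mul, quenched_succ_of_ne h, ← ih]
      rw [integral_walkMeasure (F := fun p => pathWeight v y n (x + step p.1) p.2)
        (measurable_from_prod_countable_right fun a =>
          measurable_pathWeight (x := x + step a))
        fun p => norm_pathWeight_le_one hv]

lemma norm_quenched_le_one [NeZero d] (hv : ∀ x, 0 ≤ v x) : ‖quenched v y n x‖ ≤ 1 := by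
  rw [← integral_pathWeight hv]
  simpa using norm_integral_le_of_norm_le_const (μ := walkMeasure d)
    (.of_forall fun s => norm_pathWeight_le_one (y := y) (n := n) (x := x) hv)

lemma eventually_pathWeight_eq (v : (Fin d → ℤ) → ℝ) (y : Fin d → ℤ) (s : ℕ → Fin d × Bool) :
    ∀ᶠ n in atTop, {s : ℕ → Fin d × Bool | ∃ n, walk s n = y}.indicator
      (fun s => Real.exp (-∑ k ∈ Finset.range (firstPassage y s), v (walk s k))) s =
        pathWeight v y n 0 s := by
  by_cases h : s ∈ {s | ∃ n, walk s n = y}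
  · filter_upwards [eventually_ge_atTop (firstPassage y s)] with n hn
    rw [Set.indicator_of_mem h, pathWeight_eq_exp hn]
    · simp only [zero_add]
    · rw [zero_add]
      exact Nat.sInf_mem h
    · intro k hk
      rw [zero_add]
      exact Nat.notMem_of_lt_sInf hk
  · refine .of_forall fun n => ?_
    rw [Set.indicator_of_notMem h, pathWeight_eq_zero]
    simpa only [zero_add] using fun m _ hm => h ⟨m, hm⟩

lemma tendsto_quenched [NeZero d] (hv : ∀ x, 0 ≤ v x) (y : Fin d → ℤ) :
    Tendsto (fun n => quenched v y n 0) atTop (𝓝 (survival y v)) := by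
  simp only [← integral_pathWeight hv]
  exact tendsto_integral_of_dominated_convergence (fun _ => 1)
    (fun n => measurable_pathWeight.aestronglyMeasurable) (integrable_const 1)
    (fun n => .of_forall fun s => norm_pathWeight_le_one hv)
    (.of_forall fun s => tendsto_const_nhds.congr' (eventually_pathWeight_eq v y s))

/-! ### The Laplace transform as a local weight -/

section LaplaceTransform

variable {Ω : Type*} [MeasurableSpace Ω] {P : Measure Ω} {W : Ω → ℝ} {t u : ℝ}

lemma integral_mul_integral_le_of_monovary [IsProbabilityMeasure P] {f g : Ω → ℝ}
    (hfg : Monovary f g) (hf : Integrable f P) (hg : Integrable g P)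
    (hmul : Integrable (fun ω => f ω * g ω) P) :
    (∫ ω, f ω ∂P) * ∫ ω, g ω ∂P ≤ ∫ ω, f ω * g ω ∂P := by
  have hpoint (ω : Ω) : f ω * (∫ ω', g ω' ∂P) + (∫ ω', f ω' ∂P) * g ω ≤
      f ω * g ω + ∫ ω', f ω' * g ω' ∂P := by
    have h := integral_mono ((hg.const_mul (f ω)).add (hf.mul_const (g ω)))
      ((integrable_const (f ω * g ω)).add hmul)
      fun ω' => monovary_iff_mul_rearrangement.1 hfg ω ω'
    rwa [integral_add' (hg.const_mul _) (hf.mul_const _), integral_add' (integrable_const _) hmul,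
      integral_const_mul, integral_mul_const, integral_const, probReal_univ, one_smul] at h
  have h := integral_mono ((hf.mul_const _).add (hg.const_mul _))
    (hmul.add (integrable_const _)) hpoint
  rw [integral_add' (hf.mul_const _) (hg.const_mul _), integral_add' hmul (integrable_const _),
    integral_const_mul, integral_mul_const, integral_const, probReal_univ, one_smul] at h
  linarith

lemma integrable_exp_neg_mul [IsFiniteMeasure P] (hW : Measurable W) (h0 : ∀ ω, 0 ≤ W ω)
    (ht : 0 ≤ t) : Integrable (fun ω => Real.exp (-t * W ω)) P :=
  .of_bound (by fun_prop) 1 (.of_forall fun ω => by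
    rw [Real.norm_eq_abs, Real.abs_exp, Real.exp_le_one_iff, neg_mul]
    exact neg_nonpos.2 (mul_nonneg ht (h0 ω)))

lemma mgf_neg_mul_mgf_neg_le [IsProbabilityMeasure P] (hW : Measurable W) (h0 : ∀ ω, 0 ≤ W ω)
    (ht : 0 ≤ t) (hu : 0 ≤ u) :
    mgf W P (-t) * mgf W P (-u) ≤ mgf W P (-(t + u)) := by
  have hadd (ω : Ω) :
      Real.exp (-(t + u) * W ω) = Real.exp (-t * W ω) * Real.exp (-u * W ω) := by
    rw [← Real.exp_add]; ring_nf
  have hanti {r : ℝ} (hr : 0 ≤ r) : Antitone fun w : ℝ => Real.exp (-r * w) := fun a b hab =>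
    Real.exp_le_exp.2 (mul_le_mul_of_nonpos_left hab (neg_nonpos.2 hr))
  simp only [mgf, hadd]
  refine integral_mul_integral_le_of_monovary ?_ (integrable_exp_neg_mul hW h0 ht)
    (integrable_exp_neg_mul hW h0 hu) ?_
  · exact ((hanti ht).monovary (hanti hu)).comp_right W
  · simpa only [hadd] using integrable_exp_neg_mul hW h0 (add_nonneg ht hu)

lemma isLocalWeight_mgf_neg [IsProbabilityMeasure P] (hW : Measurable W) (h0 : ∀ ω, 0 ≤ W ω) :
    IsLocalWeight fun k : ℕ => mgf W P (-k) where
  zero := by simp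
  pos k := mgf_pos (integrable_exp_neg_mul hW h0 k.cast_nonneg)
  antitone j k hjk := integral_mono (integrable_exp_neg_mul hW h0 k.cast_nonneg)
    (integrable_exp_neg_mul hW h0 j.cast_nonneg) fun ω => Real.exp_le_exp.2
      (mul_le_mul_of_nonneg_right (neg_le_neg (Nat.cast_le.2 hjk)) (h0 ω))
  mul_le j k := by
    simpa using mgf_neg_mul_mgf_neg_le hW h0 j.cast_nonneg (k.cast_nonneg (α := ℝ))

end LaplaceTransform

/-! ### Averaging over the potential -/

section Annealing

variable {Ω : Type*} [MeasurableSpace Ω] {P : Measure Ω} {V : (Fin d → ℤ) → Ω → ℝ}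

namespace IsIIDPotential

lemma integral_exp_sum (hV : IsIIDPotential P V) (L : (Fin d → ℤ) →₀ ℕ) :
    ∫ ω, Real.exp (-L.sum fun z k => k * V z ω) ∂P =
      fieldWeight (fun k : ℕ => mgf (V 0) P (-k)) L := by
  have hind : iIndepFun (fun z ω => (L z : ℝ) * V z ω) P :=
    hV.indep.comp _ fun z => measurable_const_mul (L z : ℝ)
  have hsum := hind.mgf_sum (t := -1) (fun z => (hV.measurable z).const_mul _) L.support
  simp only [mgf_const_mul, mgf_congr_identDistrib (hV.identDistrib _), mul_neg_one] at hsum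
  rw [fieldWeight, Finsupp.prod, ← hsum]
  simp [mgf, Finsupp.sum]

lemma measurable_quenched (hV : IsIIDPotential P V) (n : ℕ) (x : Fin d → ℤ) :
    Measurable fun ω => quenched (fun x => V x ω) y n x := by
  induction n generalizing x with
  | zero => exact measurable_const
  | succ n ih =>
    refine .ite (.const _) measurable_const ((hV.measurable x).neg.exp.mul ?_)
    simp only [Finset.expect_eq_sum_div_card]
    exact (Finset.measurable_fun_sum _ fun a _ => ih _).div_const _

lemma integrable_exp_sum_mul_quenched [NeZero d] [IsProbabilityMeasure P]
    (hV : IsIIDPotential P V) (n : ℕ) (x : Fin d → ℤ) (L : (Fin d → ℤ) →₀ ℕ) :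
    Integrable (fun ω => Real.exp (-L.sum fun z k => k * V z ω) *
      quenched (fun x => V x ω) y n x) P := by
  have hmeas : Measurable fun ω => L.sum fun z k => (k : ℝ) * V z ω :=
    Finset.measurable_fun_sum _ fun z _ => (hV.measurable z).const_mul _
  refine .of_bound (hmeas.neg.exp.mul (hV.measurable_quenched n x)).aestronglyMeasurable 1
    (.of_forall fun ω => ?_)
  rw [norm_mul, Real.norm_eq_abs, Real.abs_exp]
  refine mul_le_one₀ (Real.exp_le_one_iff.2 (neg_nonpos.2 ?_)) (norm_nonneg _)
    (norm_quenched_le_one fun x => hV.nonneg x ω)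
  exact Finset.sum_nonneg fun z _ => mul_nonneg (Nat.cast_nonneg _) (hV.nonneg z ω)

lemma integral_exp_sum_mul_quenched [NeZero d] (hV : IsIIDPotential P V) (n : ℕ)
    (x : Fin d → ℤ) (L : (Fin d → ℤ) →₀ ℕ) :
    ∫ ω, Real.exp (-L.sum fun z k => k * V z ω) * quenched (fun x => V x ω) y n x ∂P =
      annealed step (fun k : ℕ => mgf (V 0) P (-k)) y n x L := by
  have := hV.indep.isProbabilityMeasure
  induction n generalizing x L with
  | zero =>
    obtain rfl | h := eq_or_ne x y
    · simp [quenched_self, annealed_self, hV.integral_exp_sum]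
    · simp [quenched, annealed_zero_of_ne, h]
  | succ n ih =>
    obtain rfl | h := eq_or_ne x y
    · simp [quenched_self, annealed_self, hV.integral_exp_sum]
    have hvisit (ω : Ω) : (L + Finsupp.single x 1).sum (fun z k => (k : ℝ) * V z ω) =
        L.sum (fun z k => (k : ℝ) * V z ω) + V x ω := by
      rw [Finsupp.sum_add_index' (by simp) fun _ _ _ => by push_cast; ring,
        Finsupp.sum_single_index (by simp), Nat.cast_one, one_mul]
    simp only [annealed_succ_of_ne h, ← ih, quenched_succ_of_ne h, Finset.expect_eq_sum_div_card]
    rw [← integral_finsetSum _ fun a _ => hV.integrable_exp_sum_mul_quenched n _ _,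
      ← integral_div]
    refine integral_congr_ae (.of_forall fun ω => ?_)
    simp only [hvisit, neg_add, Real.exp_add, ← Finset.mul_sum]
    ring

lemma integral_survival [NeZero d] (hV : IsIIDPotential P V) (y : Fin d → ℤ) :
    ∫ ω, survival y (fun x => V x ω) ∂P =
      annealedSurvival step (fun k : ℕ => mgf (V 0) P (-k)) y := by
  have := hV.indep.isProbabilityMeasure
  have hannealed (n : ℕ) : ∫ ω, quenched (fun x => V x ω) y n 0 ∂P =
      annealed step (fun k : ℕ => mgf (V 0) P (-k)) y n 0 0 := by
    simp [← hV.integral_exp_sum_mul_quenched]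
  refine tendsto_nhds_unique (tendsto_integral_of_dominated_convergence (fun _ => 1)
    (fun n => (hV.measurable_quenched n 0).aestronglyMeasurable) (integrable_const 1)
    (fun n => .of_forall fun ω => norm_quenched_le_one fun x => hV.nonneg x ω)
    (.of_forall fun ω => tendsto_quenched (fun x => hV.nonneg x ω) y)) ?_
  simpa only [hannealed] using
    (isLocalWeight_mgf_neg (hV.measurable 0) (hV.nonneg 0)).tendsto_annealed y

lemma isAnnealedExponent_iff [NeZero d] (hV : IsIIDPotential P V)
    (hφ : IsLocalWeight fun k : ℕ => mgf (V 0) P (-k))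
    {p : Seminorm ℝ (EuclideanSpace ℝ (Fin d))} :
    IsAnnealedExponent P V p ↔ p = annealedExponent hφ := by
  have htendsto := tendsto_annealedExponent (d := d) hφ
  simp only [← hV.integral_survival] at htendsto
  refine ⟨fun hp => ?_, fun hp => hp ▸ htendsto⟩
  exact seminorm_eq_of_eq_on_lattice (span_range_toEuclideanHom (d := d)) fun z =>
    tendsto_nhds_unique (hp z) (htendsto z)

end IsIIDPotential

end Annealing

/-! ### Truncated means -/

/-- The truncation of a real number to the interval `[0, M]`. Its continuity makes truncated means
pass to limits in distribution. -/
def truncate (M x : ℝ) : ℝ := max 0 (min x M)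

section Truncation

variable {M x : ℝ}

lemma truncate_nonneg : 0 ≤ truncate M x := le_max_left _ _

lemma norm_truncate_le (hM : 0 ≤ M) : ‖truncate M x‖ ≤ M :=
  (Real.norm_of_nonneg truncate_nonneg).trans_le (max_le hM (min_le_right _ _))

lemma truncate_le_self (hx : 0 ≤ x) : truncate M x ≤ x := max_le hx (min_le_left _ _)

lemma monotone_truncate_left : Monotone fun M => truncate M x := fun _ _ h =>
  max_le_max_left 0 (min_le_min_left x h)

lemma continuous_truncate : Continuous (truncate M) := by
  unfold truncate; fun_prop

lemma tendsto_integral_truncate {ι Ω' : Type*} {Ω : ι → Type*} [∀ i, MeasurableSpace (Ω i)]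
    {P : (i : ι) → Measure (Ω i)} [∀ i, IsProbabilityMeasure (P i)] [MeasurableSpace Ω']
    {P' : Measure Ω'} [IsProbabilityMeasure P'] {X : (i : ι) → Ω i → ℝ} {Z : Ω' → ℝ}
    {l : Filter ι} (h : TendstoInDistribution X l Z P P') (hM : 0 ≤ M) :
    Tendsto (fun i => ∫ ω, truncate M (X i ω) ∂P i) l (𝓝 (∫ ω, truncate M (Z ω) ∂P')) := by
  have hlim := ProbabilityMeasure.tendsto_iff_forall_integral_tendsto.1 h.tendsto
    (.ofNormedAddCommGroup (truncate M) continuous_truncate M fun _ => norm_truncate_le hM)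
  simp only [ProbabilityMeasure.coe_mk, BoundedContinuousFunction.coe_ofNormedAddCommGroup] at hlim
  rw [integral_map h.aemeasurable_limit continuous_truncate.aestronglyMeasurable] at hlim
  exact hlim.congr fun i =>
    integral_map (h.forall_aemeasurable i) continuous_truncate.aestronglyMeasurable

variable {Ω : Type*} [MeasurableSpace Ω] {P : Measure Ω} {Z : Ω → ℝ}

lemma integrable_truncate [IsFiniteMeasure P] (hZ : AEMeasurable Z P) (hM : 0 ≤ M) :
    Integrable (fun ω => truncate M (Z ω)) P :=
  .of_bound (continuous_truncate.measurable.comp_aemeasurable hZ).aestronglyMeasurable M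
    (.of_forall fun _ => norm_truncate_le hM)

lemma tendsto_lintegral_truncate (hZ : AEMeasurable Z P) :
    Tendsto (fun n : ℕ => ∫⁻ ω, ENNReal.ofReal (truncate n (Z ω)) ∂P) atTop
      (𝓝 (∫⁻ ω, ENNReal.ofReal (Z ω) ∂P)) := by
  refine lintegral_tendsto_of_tendsto_of_monotone
    (fun n => (continuous_truncate.measurable.comp_aemeasurable hZ).ennreal_ofReal)
    (.of_forall fun ω m n hmn => ENNReal.ofReal_le_ofReal
      (monotone_truncate_left (Nat.cast_le.2 hmn)))
    (.of_forall fun ω => tendsto_const_nhds.congr' ?_)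
  obtain ⟨N, hN⟩ := exists_nat_ge (Z ω)
  filter_upwards [eventually_ge_atTop N] with n hn
  rw [truncate, min_eq_left (hN.trans (Nat.cast_le.2 hn)), ENNReal.ofReal_max, ENNReal.ofReal_zero,
    max_eq_right zero_le]

lemma exists_lt_integral_truncate [IsFiniteMeasure P] (hZ : AEMeasurable Z P) {r : ℝ}
    (h : ENNReal.ofReal r < ∫⁻ ω, ENNReal.ofReal (Z ω) ∂P) :
    ∃ M : ℝ, 0 ≤ M ∧ r < ∫ ω, truncate M (Z ω) ∂P := by
  obtain ⟨n, hn⟩ := ((tendsto_lintegral_truncate hZ).eventually_const_lt h).exists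
  rw [← ofReal_integral_eq_lintegral_ofReal (integrable_truncate hZ n.cast_nonneg)
    (.of_forall fun ω => truncate_nonneg)] at hn
  exact ⟨n, n.cast_nonneg, (ENNReal.ofReal_lt_ofReal_iff'.1 hn).1⟩

end Truncation

/-! ### Bounds on the Laplace transform -/

section LaplaceBounds

variable {Ω : Type*} [MeasurableSpace Ω] {P : Measure Ω} [IsProbabilityMeasure P] {W : Ω → ℝ}

lemma exp_neg_le_one_sub_add_sq {x : ℝ} (hx : 0 ≤ x) : Real.exp (-x) ≤ 1 - x + x ^ 2 / 2 := by
  have hquad : 0 < 1 - x + x ^ 2 / 2 := by nlinarith [sq_nonneg (x - 1)]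
  rw [Real.exp_neg, inv_le_comm₀ (Real.exp_pos x) hquad]
  refine le_trans ?_ (Real.quadratic_le_exp_of_nonneg hx)
  rw [inv_le_iff_one_le_mul₀ hquad]
  nlinarith [sq_nonneg (x ^ 2)]

lemma mgf_neg_le_exp {w : Ω → ℝ} (hW : Measurable W) (hw : Measurable w) (hw0 : ∀ ω, 0 ≤ w ω)
    (hwW : ∀ ω, w ω ≤ W ω) {b : ℝ} (hwb : ∀ ω, w ω ≤ b) {t : ℝ} (ht : 0 ≤ t) :
    mgf W P (-t) ≤ Real.exp (-(∫ ω, w ω ∂P) * t + b ^ 2 / 2 * t ^ 2) := by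
  have hint : Integrable w P := .of_bound hw.aestronglyMeasurable b
    (.of_forall fun ω => (Real.norm_of_nonneg (hw0 ω)).trans_le (hwb ω))
  have hpoint (ω : Ω) : Real.exp (-t * W ω) ≤ (1 + b ^ 2 / 2 * t ^ 2) - t * w ω := by
    have hexp := exp_neg_le_one_sub_add_sq (mul_nonneg ht (hw0 ω))
    have hmono : Real.exp (-t * W ω) ≤ Real.exp (-(t * w ω)) :=
      Real.exp_le_exp.2 (by nlinarith [hwW ω])
    have hsq : w ω ^ 2 ≤ b ^ 2 := pow_le_pow_left₀ (hw0 ω) (hwb ω) 2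
    nlinarith [sq_nonneg t]
  have h := integral_mono (integrable_exp_neg_mul hW (fun ω => (hw0 ω).trans (hwW ω)) ht)
    ((integrable_const _).sub (hint.const_mul t)) hpoint
  rw [integral_sub' (integrable_const _) (hint.const_mul t), integral_const, probReal_univ,
    one_smul, integral_const_mul] at h
  exact h.trans (le_trans (by linarith) (Real.add_one_le_exp _))

lemma mgf_neg_le_exp_truncate (hW : Measurable W) (h0 : ∀ ω, 0 ≤ W ω) {γ M t : ℝ} (hγ : 0 < γ)
    (hM : 0 ≤ M) (ht : 0 ≤ t) :
    mgf W P (-t) ≤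
      Real.exp (-(γ * ∫ ω, truncate M (W ω / γ) ∂P) * t + (γ * M) ^ 2 / 2 * t ^ 2) := by
  rw [← integral_const_mul]
  refine mgf_neg_le_exp hW ((continuous_truncate.measurable.comp (hW.div_const _)).const_mul _)
    (fun ω => mul_nonneg hγ.le truncate_nonneg) (fun ω => ?_)
    (fun ω => mul_le_mul_of_nonneg_left ((le_abs_self _).trans (norm_truncate_le hM)) hγ.le) ht
  calc γ * truncate M (W ω / γ) ≤ γ * (W ω / γ) :=
        mul_le_mul_of_nonneg_left (truncate_le_self (div_nonneg (h0 ω) hγ.le)) hγ.le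
    _ = W ω := mul_div_cancel₀ _ hγ.ne'

lemma mgf_neg_one_lt_one (hW : Measurable W) (h0 : ∀ ω, 0 ≤ W ω) (hP : P {ω | 0 < W ω} ≠ 0) :
    mgf W P (-1) < 1 := by
  have hint := integrable_exp_neg_mul (P := P) hW h0 zero_le_one
  have hnonneg : 0 ≤ fun ω => 1 - Real.exp (-1 * W ω) := fun ω =>
    sub_nonneg.2 (Real.exp_le_one_iff.2 (by linarith [h0 ω]))
  have hsupport : {ω | 0 < W ω} ⊆ Function.support fun ω => 1 - Real.exp (-1 * W ω) :=
    fun ω (hω : 0 < W ω) => (sub_pos.2 (Real.exp_lt_one_iff.2 (by linarith))).ne'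
  have h := (integral_pos_iff_support_of_nonneg hnonneg ((integrable_const 1).sub hint)).2
    ((pos_iff_ne_zero.2 hP).trans_le (measure_mono hsupport))
  rw [integral_sub (integrable_const 1) hint, integral_const, probReal_univ, one_smul] at h
  exact sub_pos.1 h

end LaplaceBounds

/-! ### Small potentials -/

lemma crossingFactor_div_mul {g : ℝ} (hg : g ≠ 0) (D K s M : ℝ) :
    crossingFactor D (K / g) (s * g) ((g ^ 2 * M) ^ 2 / 2) =
      Real.exp 1 / Real.cosh (s * (K - g)) +
        M ^ 2 / 2 * (D * (g * (g + 4 * D * (K + g)) * (K + 2 * g) ^ 2)) := by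
  rw [crossingFactor, show s * g * (K / g - 1) = s * (K - g) by field_simp]
  congr 1
  field_simp

lemma exp_one_div_cosh_lt {x y : ℝ} (h : x + 2 ≤ y) :
    Real.exp 1 / Real.cosh y < Real.exp (-x) := by
  rw [div_lt_iff₀ (Real.cosh_pos _), Real.cosh_eq]
  have hexp : Real.exp 1 * Real.exp 1 ≤ Real.exp (-x) * Real.exp y := by
    rw [← Real.exp_add, ← Real.exp_add]
    exact Real.exp_le_exp.2 (by linarith)
  have htwo : 2 < Real.exp 1 := by linarith [Real.exp_one_gt_d9]
  nlinarith [mul_pos (Real.exp_pos (-x)) (Real.exp_pos (-y))]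

lemma exists_eventually_crossingFactor_le {s t : ℝ} (hts : t < s) (D M : ℝ) :
    ∃ K > 0, ∀ᶠ g in 𝓝[>] (0 : ℝ),
      crossingFactor D (K / g) (s * g) ((g ^ 2 * M) ^ 2 / 2) ≤ Real.exp (-(t * K)) := by
  have hst : 0 < s - t := sub_pos.2 hts
  refine ⟨2 / (s - t), div_pos two_pos hst, ?_⟩
  set K := 2 / (s - t)
  have hcont : ContinuousAt (fun g : ℝ => Real.exp 1 / Real.cosh (s * (K - g)) +
      M ^ 2 / 2 * (D * (g * (g + 4 * D * (K + g)) * (K + 2 * g) ^ 2))) 0 :=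
    .add (.div₀ (by fun_prop) (Real.continuous_cosh.comp (by fun_prop)).continuousAt
      (Real.cosh_pos _).ne') (by fun_prop)
  have hzero : Real.exp 1 / Real.cosh (s * K) < Real.exp (-(t * K)) :=
    exp_one_div_cosh_lt (le_of_eq (by simp only [K]; field_simp; ring))
  filter_upwards [self_mem_nhdsWithin, nhdsWithin_le_nhds
    (hcont.eventually_lt_const (u := Real.exp (-(t * K))) (by simpa using hzero))] with g hg hlt
  rw [crossingFactor_div_mul (ne_of_gt hg)]
  exact hlt.le

section SmallPotential

variable {d : ℕ} [NeZero d]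

lemma mul_norm_le_annealedExponent_of_crossingFactor_le {φ : ℕ → ℝ} (hφ : IsLocalWeight φ)
    {R s t c η : ℝ} (hR : 1 ≤ R) (ht : 0 ≤ t) (hη : 0 ≤ η)
    (hφc : ∀ k : ℕ, φ k ≤ Real.exp (-c * k + η * (k : ℝ) ^ 2)) (hs : s ^ 2 ≤ 2)
    (hsc : s ^ 2 / 2 * (1 + s ^ 2 / 2) * (d : ℝ)⁻¹ ≤ c)
    (hρ : crossingFactor d R s η ≤ Real.exp (-(t * R))) (ℓ : EuclideanSpace ℝ (Fin d)) :
    t * ‖ℓ‖ ≤ annealedExponent hφ ℓ := by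
  refine mul_norm_le_annealedExponent hφ hR ht hρ (fun θ hθ => ⟨_, isSlabMajorant_slabMajorant
    step_reverseStep (abs_projection_step_le hθ) d.cast_nonneg ?_ hφ hR hη hφc ?_⟩) ℓ
  · rw [expect_sq_projection_step hθ, mul_inv_cancel₀ (Nat.cast_ne_zero.2 (NeZero.ne d))]
  · exact expect_cosh_mul_le_exp (abs_projection_step_le hθ) hs
      (by rwa [expect_sq_projection_step hθ])

variable {ι Ω' : Type*} {Ω : ι → Type*} [∀ i, MeasurableSpace (Ω i)]
  {P : (i : ι) → Measure (Ω i)} [∀ i, IsProbabilityMeasure (P i)] [MeasurableSpace Ω']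
  {P' : Measure Ω'} [IsProbabilityMeasure P'] {W : (i : ι) → Ω i → ℝ} {Z : Ω' → ℝ}
  {l : Filter ι} {γ : ι → ℝ}

lemma eventually_mul_norm_le_annealedExponent (hW : ∀ i, Measurable (W i))
    (h0 : ∀ i ω, 0 ≤ W i ω) (hγ : Tendsto γ l (𝓝[>] 0))
    (hlim : TendstoInDistribution (fun i ω => W i ω / γ i) l Z P P') {s t M : ℝ} (ht : 0 ≤ t)
    (hts : t < s) (hM : 0 ≤ M) (hs : s ^ 2 / (2 * d) < ∫ ω, truncate M (Z ω) ∂P')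
    (ℓ : EuclideanSpace ℝ (Fin d)) :
    ∀ᶠ i in l,
      t * ‖ℓ‖ ≤ annealedExponent (isLocalWeight_mgf_neg (P := P i) (hW i) (h0 i)) ℓ / √(γ i) := by
  obtain ⟨K, hK, hρ⟩ := exists_eventually_crossingFactor_le hts d M
  have hsqrt : Tendsto (fun i => √(γ i)) l (𝓝[>] 0) := by
    refine tendsto_nhdsWithin_iff.2 ⟨?_, ?_⟩
    · simpa using (hγ.mono_right nhdsWithin_le_nhds).sqrt
    · filter_upwards [hγ self_mem_nhdsWithin] with i hi using Real.sqrt_pos.2 hi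
  have hnhds := hsqrt.mono_right nhdsWithin_le_nhds
  have hsmall : Tendsto (fun i => (s * √(γ i)) ^ 2) l (𝓝 0) := by
    simpa using (hnhds.const_mul s).pow 2
  have hdrift : Tendsto (fun i => s ^ 2 / (2 * d) * (1 + (s * √(γ i)) ^ 2 / 2)) l
      (𝓝 (s ^ 2 / (2 * d))) := by
    simpa using ((hsmall.div_const 2).const_add 1).const_mul (s ^ 2 / (2 * d))
  filter_upwards [hsqrt.eventually hρ, hsqrt self_mem_nhdsWithin, hγ self_mem_nhdsWithin,
    hnhds.eventually_le_const hK, hsmall.eventually_le_const two_pos,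
    hdrift.eventually_lt (tendsto_integral_truncate hlim hM) hs]
    with i hρi (hgi : 0 < √(γ i)) (hγi : 0 < γ i) hwidth hsi hmean
  rw [le_div_iff₀ hgi, mul_right_comm]
  refine mul_norm_le_annealedExponent_of_crossingFactor_le _ (R := K / √(γ i)) (s := s * √(γ i))
    (η := (γ i * M) ^ 2 / 2) ((one_le_div hgi).2 hwidth) (by positivity) (by positivity)
    (fun k => mgf_neg_le_exp_truncate (hW i) (h0 i) hγi hM k.cast_nonneg) hsi ?_ ?_ ℓ
  · refine le_trans (le_of_eq ?_) (mul_le_mul_of_nonneg_left hmean.le hγi.le)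
    rw [mul_pow, Real.sq_sqrt hγi.le]
    ring
  · rw [Real.sq_sqrt hγi.le] at hρi
    rwa [mul_assoc, mul_div_cancel₀ _ hgi.ne']

lemma sqrt_mul_norm_le_liminf_annealedExponent (hW : ∀ i, Measurable (W i))
    (h0 : ∀ i ω, 0 ≤ W i ω) (hγ : Tendsto γ l (𝓝[>] 0))
    (hlim : TendstoInDistribution (fun i ω => W i ω / γ i) l Z P P')
    (ℓ : EuclideanSpace ℝ (Fin d)) :
    (2 * (d : ℝ≥0∞) * ∫⁻ ω, ENNReal.ofReal (Z ω) ∂P') ^ (1 / 2 : ℝ) * ENNReal.ofReal ‖ℓ‖ ≤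
      liminf (fun i => ENNReal.ofReal
        (annealedExponent (isLocalWeight_mgf_neg (P := P i) (hW i) (h0 i)) ℓ / √(γ i))) l := by
  refine ENNReal.mul_le_of_forall_lt fun a ha b hb => ?_
  obtain ⟨c, hac, hc⟩ := exists_between ha
  lift c to NNReal using ne_top_of_lt hc
  lift a to NNReal using ne_top_of_lt hac
  have hmean : ENNReal.ofReal ((c : ℝ) ^ 2 / (2 * d)) < ∫⁻ ω, ENNReal.ofReal (Z ω) ∂P' := by
    rw [one_div, ENNReal.lt_rpow_inv_iff two_pos, ENNReal.rpow_two] at hc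
    have hd : 0 < 2 * (d : ℝ) := mul_pos two_pos (Nat.cast_pos.2 (NeZero.pos d))
    rw [ENNReal.ofReal_div_of_pos hd]
    refine ENNReal.div_lt_of_lt_mul' ?_
    simpa [ENNReal.ofReal_mul, ENNReal.ofReal_pow] using hc
  obtain ⟨M, hM, hs⟩ := exists_lt_integral_truncate hlim.aemeasurable_limit hmean
  refine le_liminf_of_le (by isBoundedDefault) ?_
  filter_upwards [eventually_mul_norm_le_annealedExponent hW h0 hγ hlim a.coe_nonneg
    (NNReal.coe_lt_coe.2 (ENNReal.coe_lt_coe.1 hac)) hM hs ℓ] with i hi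
  calc a * b ≤ a * ENNReal.ofReal ‖ℓ‖ := by gcongr
    _ = ENNReal.ofReal (a * ‖ℓ‖) := by
      rw [ENNReal.ofReal_mul a.coe_nonneg, ENNReal.ofReal_coe_nnreal]
    _ ≤ _ := ENNReal.ofReal_le_ofReal hi

end SmallPotential

end RandomPotential

end

theorem mainTheorem4_general {d : ℕ} [NeZero d] {ι : Type*} {Ω : ι → Type*}
    [∀ i, MeasurableSpace (Ω i)] (P : (i : ι) → Measure (Ω i)) [∀ i, IsProbabilityMeasure (P i)]
    (V : (i : ι) → (Fin d → ℤ) → Ω i → ℝ) (hV : ∀ i, RandomPotential.IsIIDPotential (P i) (V i))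
    {Ω' : Type*} [MeasurableSpace Ω'] (P' : Measure Ω') [IsProbabilityMeasure P'] (V' : Ω' → ℝ)
    (l : Filter ι) (γ : ι → ℝ) (hγ : Tendsto γ l (𝓝[>] 0))
    (hlim : TendstoInDistribution (fun i ω => V i 0 ω / γ i) l V' P P') :
    ∃ β : ι → Seminorm ℝ (EuclideanSpace ℝ (Fin d)),
      (∀ i p, RandomPotential.IsAnnealedExponent (P i) (V i) p ↔ p = β i) ∧
      (∀ i, P i {ω | 0 < V i 0 ω} ≠ 0 → ∀ ℓ, ℓ ≠ 0 → 0 < β i ℓ) ∧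
      ∀ ℓ : EuclideanSpace ℝ (Fin d),
        (2 * (d : ℝ≥0∞) * ∫⁻ ω, ENNReal.ofReal (V' ω) ∂P') ^ (1 / 2 : ℝ) * ENNReal.ofReal ‖ℓ‖ ≤
          liminf (fun i => ENNReal.ofReal (β i ℓ / Real.sqrt (γ i))) l := by
  have hmeas i := (hV i).measurable 0
  have hnonneg i := (hV i).nonneg 0
  have hφ i := RandomPotential.isLocalWeight_mgf_neg (P := P i) (hmeas i) (hnonneg i)
  refine ⟨fun i => RandomPotential.annealedExponent (hφ i),
    fun i p => (hV i).isAnnealedExponent_iff (hφ i), fun i hP ℓ hℓ => ?_, fun ℓ => ?_⟩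
  · refine RandomPotential.annealedExponent_pos (hφ i) ?_ hℓ
    simpa using RandomPotential.mgf_neg_one_lt_one (hmeas i) (hnonneg i) hP
  · exact RandomPotential.sqrt_mul_norm_le_liminf_annealedExponent hmeas hnonneg hγ hlim ℓ

theorem mainTheorem4 {d : ℕ} [NeZero d]
    {Ω : Set.Ioi (0 : ℝ) → Type*} [∀ γ, MeasurableSpace (Ω γ)]
    (P : (γ : Set.Ioi (0 : ℝ)) → Measure (Ω γ)) [∀ γ, IsProbabilityMeasure (P γ)]
    (V : (γ : Set.Ioi (0 : ℝ)) → (Fin d → ℤ) → Ω γ → ℝ)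
    (hV : ∀ γ, RandomPotential.IsIIDPotential (P γ) (V γ))
    {Ω' : Type*} [MeasurableSpace Ω'] (P' : Measure Ω') [IsProbabilityMeasure P']
    (V' : Ω' → ℝ)
    (hlim : TendstoInDistribution (fun γ ω => V γ 0 ω / (γ : ℝ))
      (comap (Subtype.val : Set.Ioi (0 : ℝ) → ℝ) (𝓝[>] 0)) V' P P') :
    ∃ β : Set.Ioi (0 : ℝ) → Seminorm ℝ (EuclideanSpace ℝ (Fin d)),
      (∀ γ p, RandomPotential.IsAnnealedExponent (P γ) (V γ) p ↔ p = β γ) ∧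
      (∀ γ, P γ {ω | 0 < V γ 0 ω} ≠ 0 → ∀ ℓ, ℓ ≠ 0 → 0 < β γ ℓ) ∧
      ∀ ℓ : EuclideanSpace ℝ (Fin d),
        (2 * (d : ℝ≥0∞) * ∫⁻ ω, ENNReal.ofReal (V' ω) ∂P') ^ (1 / 2 : ℝ) * ENNReal.ofReal ‖ℓ‖ ≤
          liminf (fun γ : Set.Ioi (0 : ℝ) => ENNReal.ofReal (β γ ℓ / Real.sqrt (γ : ℝ)))
            (comap (Subtype.val : Set.Ioi (0 : ℝ) → ℝ) (𝓝[>] 0)) :=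
  mainTheorem4_general P V hV P' V' _ _ tendsto_comap hlim
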